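/- Let $\mathcal X,\Phi$ be Polish spaces, each with a $\sigma$-algebra containing the open sets (for instance the Borel $\sigma$-algebra). Put $\mathcal Y=\mathcal X\times\Phi$ with the product topology and product $\sigma$-algebra, and let $\mathcal I$ be a measurable space and $\nu$ a probability measure on $\mathcal X$. Let $(y,\gamma,A)\mapsto P_\gamma(y,A)$ be a Markov transition kernel from $\mathcal Y\times\mathcal I$ to $\mathcal Y$, and for each $\gamma\in\mathcal I$ let $\pi_\gamma$ be an invariant probability measure of $P_\gamma$ with $\pi_\gamma(B\times\Phi)=\nu(B)$ for all measurable $B\subseteq\mathcal X$. *The chain.* Let $\beta>0$, $T_m=\sum_{j=1}^m\lceil j^\beta\rceil$ (so $T_0=0$). On a probability space $(\Omega,\mathcal F,\mathbb P)$ let $(Y_n,\Gamma_n)_{n\ge0}$ be a $\mathcal Y\times\mathcal I$-valued process, $Y_n=(X_n,\phi_n)$, with $\mathcal F_n=\sigma(Y_0,\dots,Y_n,\Gamma_0,\dots,\Gamma_n)$, such that: $(Y_0,\Gamma_0)\equiv(y_0,\gamma_0)$ is deterministic; $\mathbb P[Y_{n+1}\in B\mid\mathcal F_n]=P_{\Gamma_n}(Y_n,B)$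 almost surely for all $n\ge 0$ and measurable $B\subseteq\mathcal Y$; $\Gamma_n=U_n(Y_0,\dots,Y_n,\Gamma_0,\dots,\Gamma_{n-1})$ for measurable maps $U_n$; and $\Gamma_{i_1}=\Gamma_{i_2}$ whenever $i_1,i_2\in\{T_j,\dots,T_{j+1}-1\}$ for some $j\ge0$. *Contraction.* Let $d:\mathcal Y\times\mathcal Y\to[0,\infty)$ be symmetric and lower semicontinuous with $d(x,y)=0\iff x=y$. Put $\mathcal W(\mu_1,\mu_2)=\inf_\xi\int d\,\mathrm d\xi$, the infimum over all couplings $\xi$ of $\mu_1,\mu_2$, and $\tau(Q)=\sup_{y_1\ne y_2}\mathcal W(Q(y_1,\cdot),Q(y_2,\cdot))/d(y_1,y_2)$ for a transition kernel $Q$ on $\mathcal Y$. Assume that there are $M\in[1,\infty)$, $\tau\in[0,1)$ and an integer $k_0\ge1$ with $\tau(P_\gamma)\le M$ and $\tau(P_\gamma^{k_0})\le\tau$ for all $\gamma\in\mathcal I$. *Lyapunov condition.* Assume that there are a measurable $V:\mathcal Y\to[1,\infty)$ and constants $\kappa\in(0,1)$, $b\in(0,\infty)$, $p>2$, $K\in(0,\infty)$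 with $P_\gamma V(y)\le\kappa V(y)+b$ and $d(y_1,y_2)\le K\,(V(y_1)^{1/p}+V(y_2)^{1/p})$ for all $\gamma\in\mathcal I$ and $y,y_1,y_2\in\mathcal Y$. *Integrand.* Let $f:\mathcal X\to\mathbb R$ be measurable with $\nu(|f|)<\infty$, and let $h(x,\phi)=f(x)$ satisfy $|h(y_1)-h(y_2)|\le L\,d(y_1,y_2)$ for some $L\in(0,\infty)$ and all $y_1,y_2\in\mathcal Y$, as well as $|h|\le V^{1/p}$. Then, for every $\varepsilon>\max\{0,\frac1{1+\beta}+\frac1p-\frac12\}$, there is a measurable $C:\Omega\to\mathbb R$ such that for $\mathbb P$-almost every $\omega$ and all integers $n\ge1$, $$\left|\frac1n\sum_{j=1}^n\bigl(f(X_j(\omega))-\nu(f)\bigr)\right|\le\frac{C(\omega)}{n^{1/2-\varepsilon}}.$$ -/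

import Mathlib

open MeasureTheory ProbabilityTheory
open scoped NNReal ENNReal

namespace AdaptiveMCMC

noncomputable section

/-- Distance-like functions on a topological space: symmetric, vanishing exactly on the diagonal,
and lower semicontinuous for the product topology. -/
structure IsDistanceLike {A : Type*} [TopologicalSpace A] (d : A → A → ℝ≥0) : Prop where
  symm : ∀ x y, d x y = d y x
  eq_zero_iff : ∀ x y, d x y = 0 ↔ x = y
  lowerSemicontinuous : LowerSemicontinuous (fun z : A × A => d z.1 z.2)

/-- The set of couplings of two measures. -/
def couplings {A : Type*} [MeasurableSpace A] (μ₁ μ₂ : Measure A) : Set (Measure (A × A)) :=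
  {ξ | ξ.map Prod.fst = μ₁ ∧ ξ.map Prod.snd = μ₂}

/-- The Wasserstein-like function `𝒲` associated with `d` (with values in `[0, ∞]`). -/
def wasserstein {A : Type*} [MeasurableSpace A] (d : A → A → ℝ≥0) (μ₁ μ₂ : Measure A) : ℝ≥0∞ :=
  ⨅ ξ ∈ couplings μ₁ μ₂, ∫⁻ z, (d z.1 z.2 : ℝ≥0∞) ∂ξ

/-- The Wasserstein contraction coefficient `τ(Q)` of a kernel `Q` (with values in `[0, ∞]`). -/
def contractionCoeff {A : Type*} [MeasurableSpace A] (d : A → A → ℝ≥0) (Q : Kernel A A) : ℝ≥0∞ :=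
  ⨆ (y₁ : A) (y₂ : A) (_ : y₁ ≠ y₂), wasserstein d (Q y₁) (Q y₂) / (d y₁ y₂ : ℝ≥0∞)

/-- The history `σ(Y₀, …, Yₙ, Γ₀, …, Γₙ)` of the process `(Yₙ, Γₙ)`. -/
abbrev history {Ω S I : Type*} [MeasurableSpace S] [MeasurableSpace I]
    (Y : ℕ → Ω → S) (Γ : ℕ → Ω → I) (n : ℕ) : MeasurableSpace Ω :=
  ⨆ i ∈ Finset.range (n + 1),
    (MeasurableSpace.comap (Y i) inferInstance ⊔ MeasurableSpace.comap (Γ i) inferInstance)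

/-- `(Yₙ, Γₙ)` is an adaptive Markov chain Monte Carlo chain started at `(y₀, γ₀)` that uses the
kernels `P_γ = P (γ, ·)`: given the history up to time `n`, the state `Yₙ₊₁` has distribution
`P_{Γₙ}(Yₙ, ·)`, and `Γₙ` is a measurable function of `Y₀, …, Yₙ, Γ₀, …, Γₙ₋₁`. -/
structure IsAdaptiveChain {Ω S I : Type*} [MeasurableSpace Ω] [MeasurableSpace S]
    [MeasurableSpace I] (μ : Measure Ω) (P : Kernel (I × S) S) (y₀ : S) (γ₀ : I)
    (Y : ℕ → Ω → S) (Γ : ℕ → Ω → I) : Prop where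
  measurable_state : ∀ n, Measurable (Y n)
  measurable_param : ∀ n, Measurable (Γ n)
  init_state : ∀ ω, Y 0 ω = y₀
  init_param : ∀ ω, Γ 0 ω = γ₀
  transition : ∀ (n : ℕ) (B : Set S), MeasurableSet B →
    condExp (history Y Γ n) μ ((Y (n + 1) ⁻¹' B).indicator fun _ => (1 : ℝ))
      =ᵐ[μ] fun ω => (P (Γ n ω, Y n ω)).real B
  update : ∀ n : ℕ, ∃ U : (Fin (n + 1) → S) × (Fin n → I) → I, Measurable U ∧
    ∀ ω, Γ n ω = U (fun i => Y i ω, fun i => Γ i ω)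

/-- The adaptation times `T_m = ∑_{j=1}^m ⌈j^β⌉` (so `T_0 = 0`). -/
def adaptationTime (β : ℝ) (m : ℕ) : ℕ :=
  ∑ j ∈ Finset.Icc 1 m, ⌈(j : ℝ) ^ β⌉₊

/-- Adaptation is increasingly rare: `Γ` is constant on each `{T_j, …, T_{j+1} - 1}`. -/
def IsIncreasinglyRare {Ω I : Type*} (β : ℝ) (Γ : ℕ → Ω → I) : Prop :=
  ∀ j : ℕ, ∀ i₁ ∈ Set.Ico (adaptationTime β j) (adaptationTime β (j + 1)),
    ∀ i₂ ∈ Set.Ico (adaptationTime β j) (adaptationTime β (j + 1)), ∀ ω, Γ i₁ ω = Γ i₂ ω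

end

end AdaptiveMCMC

/-!
The proof decomposes the sums along the chain by means of the Poisson equation.

For a fixed parameter `γ` put `P_γ^k f` for the mean of `f` after `k` steps. By
`abs_integral_sub_le_of_contractionCoeff_le`, a kernel multiplies Lipschitz constants with respect
to `d` by at most its contraction coefficient, so the Lipschitz constants of `P_γ^k f` decay
geometrically in `k`, uniformly in `γ` (`abs_stepMean_sub_le`). The drift condition gives
`∫ V ∂π_γ ≤ b / (1 - κ)` (`lintegral_le_of_invariant`), and as `d` is dominated by `V^{1/p}`, the
series `g_γ = ∑ₖ (P_γ^k f - ν(f))` converges. It satisfies `g_γ - P_γ g_γ = f - ν(f)` and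
`|g_γ| ≤ C V^{1/p}` (`exists_poisson_solution`). Hence, with `Yₖ = (Xₖ, φₖ)`,
`f(Xₖ) - ν(f) = (g_{Γₖ}(Yₖ₊₁) - P_{Γₖ} g_{Γₖ}(Yₖ)) + (g_{Γₖ}(Yₖ) - g_{Γₖ}(Yₖ₊₁))`.

* The first terms are martingale differences for the history, with bounded second moments because
  `p > 2` and `E V(Yₖ)` is bounded (`IsAdaptiveChain.lintegral_le`). Martingale convergence and
  Kronecker's lemma show that their sums are `O(n^{1/2+ε})` (`ae_exists_abs_sum_le_rpow`).
* The second terms telescope as long as `Γ` does not change. What remains are at most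
  `((1 + β) n)^{1/(1+β)} + 1` terms (`card_changes_le`, `abs_sum_sub_le_of_card_changes_le`), each
  of size `O(V(Yₖ)^{1/p})`, that is `O(n^{r/p})` for any given `r > 1` (`ae_exists_le_rpow`). Their
  sum is `O(n^{r/p + 1/(1+β)})`, and the assumption on `ε` leaves room for an `r > 1` with
  `r/p + 1/(1+β) ≤ 1/2 + ε`.
-/

namespace AdaptiveMCMC

open Filter Topology

/-! ### Contraction of Lipschitz constants -/

section Contraction

/-- One step of a kernel `Q` multiplies Lipschitz constants with respect to `d` by at most
`τ(Q)`. Only the bound `∫ u ∂Q(y₁) - ∫ u ∂Q(y₂) ≤ ℓ 𝒲(Q(y₁), Q(y₂))` is used, which is the easy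
half of Kantorovich duality. -/
theorem abs_integral_sub_le_of_contractionCoeff_le {A : Type*} [MeasurableSpace A]
    {d : A → A → ℝ≥0} (hd : ∀ x y, d x y = 0 ↔ x = y) {Q : Kernel A A} {u : A → ℝ}
    (hu : ∀ y, Integrable u (Q y)) {ℓ c : ℝ} (hℓ : 0 ≤ ℓ) (hc : 0 ≤ c)
    (hlip : ∀ y₁ y₂, |u y₁ - u y₂| ≤ ℓ * d y₁ y₂)
    (hQ : contractionCoeff d Q ≤ ENNReal.ofReal c) (y₁ y₂ : A) :
    |∫ z, u z ∂(Q y₁) - ∫ z, u z ∂(Q y₂)| ≤ ℓ * c * d y₁ y₂ := by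
  by_cases hy : y₁ = y₂
  · simp only [hy, sub_self, abs_zero]
    positivity
  have hd0 : (d y₁ y₂ : ℝ≥0∞) ≠ 0 := by
    simpa using fun h => hy ((hd y₁ y₂).1 h)
  have hW : wasserstein d (Q y₁) (Q y₂) ≤ ENNReal.ofReal c * d y₁ y₂ := by
    have h1 : wasserstein d (Q y₁) (Q y₂) / d y₁ y₂ ≤ contractionCoeff d Q :=
      le_iSup_of_le y₁ <| le_iSup_of_le y₂ <| le_iSup_of_le hy le_rfl
    exact (ENNReal.div_le_iff hd0 ENNReal.coe_ne_top).1 (h1.trans hQ)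
  have hcoupling : ∀ ξ ∈ couplings (Q y₁) (Q y₂), ‖∫ z, u z ∂(Q y₁) - ∫ z, u z ∂(Q y₂)‖ₑ
      ≤ ENNReal.ofReal ℓ * ∫⁻ z, (d z.1 z.2 : ℝ≥0∞) ∂ξ := by
    rintro ξ ⟨h₁, h₂⟩
    have i₁ : Integrable u (ξ.map Prod.fst) := h₁ ▸ hu y₁
    have i₂ : Integrable u (ξ.map Prod.snd) := h₂ ▸ hu y₂
    have j₁ : Integrable (fun z => u z.1) ξ := i₁.comp_measurable measurable_fst
    have j₂ : Integrable (fun z => u z.2) ξ := i₂.comp_measurable measurable_snd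
    rw [← h₁, ← h₂, integral_map measurable_fst.aemeasurable i₁.aestronglyMeasurable,
      integral_map measurable_snd.aemeasurable i₂.aestronglyMeasurable,
      ← integral_sub j₁ j₂, ← lintegral_const_mul' _ _ ENNReal.ofReal_ne_top]
    refine (enorm_integral_le_lintegral_enorm _).trans (lintegral_mono fun z => ?_)
    rw [← ofReal_norm, Real.norm_eq_abs, ← ENNReal.ofReal_coe_nnreal, ← ENNReal.ofReal_mul hℓ]
    exact ENNReal.ofReal_le_ofReal (hlip _ _)
  have hdual : ‖∫ z, u z ∂(Q y₁) - ∫ z, u z ∂(Q y₂)‖ₑ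
      ≤ ENNReal.ofReal ℓ * wasserstein d (Q y₁) (Q y₂) := by
    rcases hℓ.eq_or_lt with rfl | hpos
    · -- a coupling exists, because `𝒲` is finite
      have hlt : wasserstein d (Q y₁) (Q y₂) < ⊤ :=
        hW.trans_lt (ENNReal.mul_lt_top ENNReal.ofReal_lt_top ENNReal.coe_lt_top)
      simp only [wasserstein, iInf_lt_iff] at hlt
      obtain ⟨ξ, hξ, -⟩ := hlt
      simpa using hcoupling ξ hξ
    · have h0 : ENNReal.ofReal ℓ ≠ 0 := by simpa using hpos
      simp only [wasserstein, ENNReal.mul_iInf_of_ne h0 ENNReal.ofReal_ne_top]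
      exact le_iInf₂ hcoupling
  have h := hdual.trans (mul_le_mul_right hW (ENNReal.ofReal ℓ))
  rw [← ofReal_norm, ← mul_assoc, ← ENNReal.ofReal_mul hℓ, ← ENNReal.ofReal_coe_nnreal,
    ← ENNReal.ofReal_mul (by positivity)] at h
  exact (ENNReal.ofReal_le_ofReal_iff (by positivity)).1 h

end Contraction

/-! ### Moments of invariant measures -/

section Invariant

variable {S : Type*} [MeasurableSpace S]

theorem integral_integral_of_invariant {Q : Kernel S S} {π : Measure S} (hπ : Q.Invariant π)
    {u : S → ℝ} (hu : Integrable u π) : ∫ y, ∫ z, u z ∂(Q y) ∂π = ∫ y, u y ∂π := by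
  have h : Q ∘ₖ Kernel.const Unit π = Kernel.const Unit π := by
    rw [Kernel.comp_const, hπ.def]
  have := Kernel.integral_comp (η := Q) (κ := Kernel.const Unit π) (a := ()) (f := u)
    (by rw [h]; simpa using hu)
  rw [h] at this
  simpa using this.symm

/-- A drift condition bounds the mean of `V` under every invariant probability measure. Since `V`
is not known to be integrable in advance, the drift inequality is integrated for `min V c`, which
gives `∫ V 1_{V ≤ c} ∂π ≤ b / (1 - κ)` for all `c`. -/
theorem lintegral_le_of_invariant {Q : Kernel S S} [IsMarkovKernel Q] {π : Measure S}
    [IsProbabilityMeasure π] (hπ : Q.Invariant π) {V : S → ℝ} (hV : Measurable V)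
    (hV0 : ∀ y, 0 ≤ V y) {κ b : ℝ} (hκ : κ < 1) (hb : 0 ≤ b) (hint : ∀ y, Integrable V (Q y))
    (hdrift : ∀ y, ∫ z, V z ∂(Q y) ≤ κ * V y + b) :
    ∫⁻ y, ENNReal.ofReal (V y) ∂π ≤ ENNReal.ofReal (b / (1 - κ)) := by
  have htrunc : ∀ c : ℕ, ∫⁻ y, ({y | V y ≤ c}.indicator fun y => ENNReal.ofReal (V y)) y ∂π
      ≤ ENNReal.ofReal (b / (1 - κ)) := by
    intro c
    have hs : MeasurableSet {y | V y ≤ c} := measurableSet_le hV measurable_const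
    have hmin : ∀ ρ : Measure S, IsProbabilityMeasure ρ → Integrable (fun y => min (V y) c) ρ := by
      intro ρ _
      refine Integrable.of_bound (hV.min measurable_const).aestronglyMeasurable (c : ℝ)
        (Eventually.of_forall fun y => ?_)
      rw [Real.norm_of_nonneg (le_min (hV0 y) (Nat.cast_nonneg c))]
      exact min_le_right _ _
    have hVind : Integrable ({y | V y ≤ c}.indicator V) π := by
      refine Integrable.of_bound (hV.indicator hs).aestronglyMeasurable (c : ℝ)
        (Eventually.of_forall fun y => ?_)
      by_cases hy : V y ≤ c
      · rw [Set.indicator_of_mem (by exact hy), Real.norm_of_nonneg (hV0 y)]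
        exact hy
      · rw [Set.indicator_of_notMem (by exact hy)]
        simp
    have hoind : Integrable ({y | V y ≤ c}.indicator fun _ => b) π :=
      (integrable_const b).indicator hs
    have hstep : ∀ y, ∫ z, min (V z) c ∂(Q y) ≤ min (V y) c
        - (1 - κ) * {y | V y ≤ c}.indicator V y + {y | V y ≤ c}.indicator (fun _ => b) y := by
      intro y
      by_cases hy : V y ≤ c
      · rw [Set.indicator_of_mem (by exact hy), Set.indicator_of_mem (by exact hy), min_eq_left hy]
        have := (integral_mono (hmin (Q y) inferInstance) (hint y)
          (fun z => min_le_left (V z) c)).trans (hdrift y)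
        linarith
      · rw [Set.indicator_of_notMem (by exact hy), Set.indicator_of_notMem (by exact hy),
          min_eq_right (not_le.1 hy).le]
        have := integral_mono (hmin (Q y) inferInstance) (integrable_const (c : ℝ))
          (fun z => min_le_right (V z) c)
        simpa using this
    have hle : ∫ y, {y | V y ≤ c}.indicator V y ∂π ≤ b / (1 - κ) := by
      have hint' : Integrable (fun y => min (V y) c - (1 - κ) * {y | V y ≤ c}.indicator V y
          + {y | V y ≤ c}.indicator (fun _ => b) y) π :=
        ((hmin π inferInstance).sub (hVind.const_mul _)).add hoind
      have h1 : ∫ y, min (V y) c ∂π ≤ ∫ y, (min (V y) c - (1 - κ) * {y | V y ≤ c}.indicator V y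
          + {y | V y ≤ c}.indicator (fun _ => b) y) ∂π := by
        rw [← integral_integral_of_invariant hπ (hmin π inferInstance)]
        refine integral_mono_of_nonneg (Eventually.of_forall fun y => ?_) hint'
          (Eventually.of_forall hstep)
        exact integral_nonneg fun z => le_min (hV0 z) (Nat.cast_nonneg c)
      have hsub : Integrable (fun y => min (V y) c - (1 - κ) * {y | V y ≤ c}.indicator V y) π :=
        (hmin π inferInstance).sub (hVind.const_mul _)
      rw [integral_add hsub hoind, integral_sub (hmin π inferInstance) (hVind.const_mul _), integral_const_mul] at h1
      have h2 : ∫ y, {y | V y ≤ c}.indicator (fun _ => b) y ∂π ≤ b := by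
        refine (integral_mono hoind (integrable_const b) fun y =>
          Set.indicator_le_self' (fun _ _ => hb) y).trans ?_
        simp
      rw [le_div_iff₀ (by linarith)]
      linarith
    have hcongr : ({y | V y ≤ c}.indicator fun y => ENNReal.ofReal (V y))
        = fun y => ENNReal.ofReal ({y | V y ≤ c}.indicator V y) := by
      ext y
      by_cases hy : V y ≤ c
      · rw [Set.indicator_of_mem (by exact hy), Set.indicator_of_mem (by exact hy)]
      · rw [Set.indicator_of_notMem (by exact hy), Set.indicator_of_notMem (by exact hy),
          ENNReal.ofReal_zero]
    rw [hcongr, ← ofReal_integral_eq_lintegral_ofReal hVind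
      (Eventually.of_forall fun y => Set.indicator_nonneg (fun z _ => hV0 z) y)]
    exact ENNReal.ofReal_le_ofReal hle
  have hsup : ∀ y, ENNReal.ofReal (V y)
      = ⨆ c : ℕ, ({y | V y ≤ c}.indicator fun y => ENNReal.ofReal (V y)) y := by
    intro y
    refine le_antisymm ?_ (iSup_le fun c => Set.indicator_le_self _ _ y)
    obtain ⟨c, hc⟩ := exists_nat_ge (V y)
    refine le_iSup_of_le c ?_
    rw [Set.indicator_of_mem (by exact hc)]
  rw [lintegral_congr hsup, lintegral_iSup (fun c => hV.ennreal_ofReal.indicator (measurableSet_le hV measurable_const))]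
  · exact iSup_le htrunc
  · intro c c' hcc y
    refine Set.indicator_le_indicator_of_subset (fun z (hz : V z ≤ c) => ?_)
      (fun _ => zero_le) y
    exact hz.trans (by exact_mod_cast hcc)

end Invariant

/-! ### The Poisson equation -/

section Poisson

variable {S I : Type*} [MeasurableSpace S] [MeasurableSpace I]

/-- The function `(γ, y) ↦ P_γ^k h(y)`, the mean of `h` after `k` steps of the chain whose
parameter is kept equal to `γ`. The recursion in both arguments makes the joint measurability in
`(γ, y)` apparent, which powers of the kernels `P.sectR γ` for fixed `γ` do not. -/
noncomputable def stepMean (P : Kernel (I × S) S) (h : S → ℝ) : ℕ → I × S → ℝ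
  | 0 => fun q => h q.2
  | k + 1 => fun q => ∫ z, stepMean P h k (q.1, z) ∂(P q)

theorem measurable_stepMean {P : Kernel (I × S) S} [IsMarkovKernel P] {h : S → ℝ}
    (hh : Measurable h) (k : ℕ) : Measurable (stepMean P h k) := by
  induction k with
  | zero => exact hh.comp measurable_snd
  | succ k ih =>
    have hm : Measurable fun x : (I × S) × S => stepMean P h k (x.1.1, x.2) :=
      ih.comp (measurable_fst.fst.prodMk measurable_snd)
    exact (hm.stronglyMeasurable.integral_kernel_prod_right' (κ := P)).measurable

variable {P : Kernel (I × S) S} [IsMarkovKernel P] {V : S → ℝ} {b : ℝ} {h : S → ℝ}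

theorem abs_stepMean_le (hV : ∀ q, Integrable V (P q)) (hdrift : ∀ q, ∫ z, V z ∂(P q) ≤ V q.2 + b)
    (hhV : ∀ y, |h y| ≤ V y) (k : ℕ) (q : I × S) : |stepMean P h k q| ≤ V q.2 + k * b := by
  induction k generalizing q with
  | zero => simpa [stepMean] using hhV q.2
  | succ k ih =>
    have h1 : |stepMean P h (k + 1) q| ≤ ∫ z, (V z + k * b) ∂(P q) :=
      norm_integral_le_of_norm_le (f := fun z => stepMean P h k (q.1, z))
        (g := fun z => V z + k * b)
        ((hV q).add (integrable_const _)) (Eventually.of_forall fun z => ih (q.1, z))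
    rw [integral_add (hV q) (integrable_const _)] at h1
    have h2 := hdrift q
    simp only [integral_const, probReal_univ, one_smul] at h1
    push_cast
    linarith

/-- `P_γ^k h` is integrable for every measure that integrates `V`. -/
theorem integrable_stepMean (hh : Measurable h) (hV : ∀ q, Integrable V (P q))
    (hV1 : ∀ y, 1 ≤ V y) (hb : 0 ≤ b) (hdrift : ∀ q, ∫ z, V z ∂(P q) ≤ V q.2 + b)
    (hhV : ∀ y, |h y| ≤ V y) (k : ℕ) (γ : I) {ρ : Measure S} (hρ : Integrable V ρ) :
    Integrable (fun z => stepMean P h k (γ, z)) ρ := by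
  refine (hρ.const_mul (1 + k * b)).mono'
    ((measurable_stepMean hh k).comp measurable_prodMk_left).aestronglyMeasurable
    (Eventually.of_forall fun z => ?_)
  have h1 := abs_stepMean_le hV hdrift hhV k (γ, z)
  have h2 : k * b ≤ k * b * V z := le_mul_of_one_le_right (by positivity) (hV1 z)
  rw [Real.norm_eq_abs]
  simp only at h1
  linarith

theorem integrable_pow_and_integral_le {Q : Kernel S S} [IsMarkovKernel Q] (hVm : Measurable V)
    (hV : ∀ y, Integrable V (Q y)) (hV0 : ∀ y, 0 ≤ V y)
    (hdrift : ∀ y, ∫ z, V z ∂(Q y) ≤ V y + b) (j : ℕ) (y : S) :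
    Integrable V ((Q ^ j) y) ∧ ∫ z, V z ∂((Q ^ j) y) ≤ V y + j * b := by
  induction j generalizing y with
  | zero =>
    have h1 : (Q ^ 0) y = Measure.dirac y := by
      rw [pow_zero]
      exact Kernel.id_apply y
    rw [h1, integral_dirac' _ _ hVm.stronglyMeasurable]
    exact ⟨integrable_dirac' hVm.stronglyMeasurable (by simp), by simp⟩
  | succ j ih =>
    have h1 : (Q ^ (j + 1)) = (Q ^ j) ∘ₖ Q := pow_succ Q j
    have h2 : Integrable (fun x => ∫ z, V z ∂((Q ^ j) x)) (Q y) := by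
      refine ((hV y).add (integrable_const (j * b))).mono'
        hVm.stronglyMeasurable.integral_kernel.aestronglyMeasurable (Eventually.of_forall fun x => ?_)
      rw [Real.norm_of_nonneg (integral_nonneg hV0)]
      exact (ih x).2
    have h3 : Integrable V (((Q ^ j) ∘ₖ Q) y) := by
      rw [integrable_comp_iff hVm.aestronglyMeasurable]
      refine ⟨Eventually.of_forall fun x => (ih x).1, ?_⟩
      simpa only [Real.norm_of_nonneg (hV0 _)] using h2
    rw [h1]
    refine ⟨h3, ?_⟩
    rw [Kernel.integral_comp h3]
    refine (integral_mono h2 ((hV y).add (integrable_const (j * b))) fun x => (ih x).2).trans ?_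
    have h4 := integral_add (hV y) (integrable_const (j * b))
    have h5 := hdrift y
    simp only [integral_const, probReal_univ, one_smul] at h4
    simp only [Pi.add_apply]
    rw [h4]
    push_cast
    linarith

theorem integral_stepMean_pow (hh : Measurable h) (hVm : Measurable V)
    (hV : ∀ q, Integrable V (P q)) (hV1 : ∀ y, 1 ≤ V y) (hb : 0 ≤ b)
    (hdrift : ∀ q, ∫ z, V z ∂(P q) ≤ V q.2 + b) (hhV : ∀ y, |h y| ≤ V y) (k j : ℕ) (γ : I) (y : S) :
    ∫ z, stepMean P h k (γ, z) ∂((P.sectR γ ^ j) y) = stepMean P h (k + j) (γ, y) := by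
  have hint := integrable_pow_and_integral_le (Q := P.sectR γ) hVm (fun y => hV (γ, y))
    (fun y => zero_le_one.trans (hV1 y)) (fun y => hdrift (γ, y))
  induction j generalizing y with
  | zero =>
    have h1 : (P.sectR γ ^ 0) y = Measure.dirac y := by
      rw [pow_zero]
      exact Kernel.id_apply y
    have hm : Measurable fun z => stepMean P h k (γ, z) :=
      (measurable_stepMean hh k).comp measurable_prodMk_left
    rw [h1, integral_dirac' _ _ hm.stronglyMeasurable, add_zero]
  | succ j ih =>
    have h1 : (P.sectR γ ^ (j + 1)) = (P.sectR γ ^ j) ∘ₖ P.sectR γ := pow_succ _ j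
    have h2 := integrable_stepMean hh hV hV1 hb hdrift hhV k γ (hint (j + 1) y).1
    rw [h1] at h2 ⊢
    rw [Kernel.integral_comp h2]
    simp_rw [ih]
    rfl

/-- The functions `P_γ^k h` are Lipschitz with respect to `d` with constants that decay
geometrically in `k`, uniformly in `γ`. -/
theorem abs_stepMean_sub_le {d : S → S → ℝ≥0} (hd : ∀ x y, d x y = 0 ↔ x = y) (hh : Measurable h)
    (hVm : Measurable V) (hV : ∀ q, Integrable V (P q)) (hV1 : ∀ y, 1 ≤ V y) (hb : 0 ≤ b)
    (hdrift : ∀ q, ∫ z, V z ∂(P q) ≤ V q.2 + b) (hhV : ∀ y, |h y| ≤ V y)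
    {L M ρ : ℝ} {k₀ : ℕ} (hk₀ : 1 ≤ k₀) (hL : 0 ≤ L) (hM : 1 ≤ M) (hρ : 0 < ρ) (hρ1 : ρ ≤ 1)
    (hlip : ∀ y₁ y₂, |h y₁ - h y₂| ≤ L * d y₁ y₂)
    (hone : ∀ γ, contractionCoeff d (P.sectR γ) ≤ ENNReal.ofReal M)
    (hpow : ∀ γ, contractionCoeff d (P.sectR γ ^ k₀) ≤ ENNReal.ofReal (ρ ^ k₀))
    (k : ℕ) (γ : I) (y₁ y₂ : S) :
    |stepMean P h k (γ, y₁) - stepMean P h k (γ, y₂)|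
      ≤ L * M ^ k₀ / ρ ^ k₀ * ρ ^ k * d y₁ y₂ := by
  have hcrude : ∀ (k : ℕ) (y₁ y₂ : S),
      |stepMean P h k (γ, y₁) - stepMean P h k (γ, y₂)| ≤ L * M ^ k * d y₁ y₂ := by
    intro k
    induction k with
    | zero => simpa [stepMean] using hlip
    | succ k ih =>
      intro y₁ y₂
      have := abs_integral_sub_le_of_contractionCoeff_le hd (Q := P.sectR γ)
        (u := fun z => stepMean P h k (γ, z))
        (fun y => integrable_stepMean hh hV hV1 hb hdrift hhV k γ (hV (γ, y)))
        (by positivity) (by positivity) ih (hone γ) y₁ y₂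
      rw [pow_succ, ← mul_assoc]
      exact this
  induction k using Nat.strong_induction_on generalizing y₁ y₂ with
  | _ k ih =>
    rcases lt_or_ge k k₀ with hk | hk
    · refine (hcrude k y₁ y₂).trans ?_
      refine mul_le_mul_of_nonneg_right ?_ (d y₁ y₂).coe_nonneg
      rw [div_mul_eq_mul_div, le_div_iff₀ (by positivity)]
      have h1 : M ^ k ≤ M ^ k₀ := pow_le_pow_right₀ hM hk.le
      have h2 : ρ ^ k₀ ≤ ρ ^ k := pow_le_pow_of_le_one hρ.le hρ1 hk.le
      gcongr
    · obtain ⟨j, rfl⟩ : ∃ j, k = j + k₀ := ⟨k - k₀, by omega⟩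
      have := abs_integral_sub_le_of_contractionCoeff_le hd (Q := P.sectR γ ^ k₀)
        (u := fun z => stepMean P h j (γ, z))
        (fun y => integrable_stepMean hh hV hV1 hb hdrift hhV j γ
          (integrable_pow_and_integral_le (Q := P.sectR γ) hVm (fun y => hV (γ, y))
            (fun y => zero_le_one.trans (hV1 y)) (fun y => hdrift (γ, y)) k₀ y).1)
        (by positivity) (by positivity) (ih j (by omega)) (hpow γ) y₁ y₂
      simp only [integral_stepMean_pow hh hVm hV hV1 hb hdrift hhV] at this
      rwa [mul_assoc _ (ρ ^ j), ← pow_add] at this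

theorem integral_stepMean_of_invariant (hh : Measurable h) (hV : ∀ q, Integrable V (P q))
    (hV1 : ∀ y, 1 ≤ V y) (hb : 0 ≤ b) (hdrift : ∀ q, ∫ z, V z ∂(P q) ≤ V q.2 + b)
    (hhV : ∀ y, |h y| ≤ V y) {γ : I} {π : Measure S} (hπ : (P.sectR γ).Invariant π)
    (hVπ : Integrable V π) (k : ℕ) : ∫ y, stepMean P h k (γ, y) ∂π = ∫ y, h y ∂π := by
  induction k with
  | zero => rfl
  | succ k ih =>
    rw [← ih, ← integral_integral_of_invariant hπ
      (integrable_stepMean hh hV hV1 hb hdrift hhV k γ hVπ)]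
    rfl

/-- The Poisson equation `g_γ - P_γ g_γ = h - c` has a solution `g`, jointly measurable in the
parameter and the state, with `|g| ≤ C W` uniformly in the parameter. It is
`g_γ = ∑ₖ (P_γ^k h - c)`; contraction makes the series converge geometrically. -/
theorem exists_poisson_solution {d : S → S → ℝ≥0} (hd : ∀ x y, d x y = 0 ↔ x = y)
    (hh : Measurable h) (hVm : Measurable V) (hV : ∀ q, Integrable V (P q)) {W : S → ℝ}
    (hWm : Measurable W) (hW1 : ∀ y, 1 ≤ W y) (hWV : ∀ y, W y ≤ V y) {κ : ℝ} (hκ : κ < 1)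
    (hb : 0 ≤ b) (hdrift : ∀ q, ∫ z, V z ∂(P q) ≤ κ * V q.2 + b) (hhW : ∀ y, |h y| ≤ W y)
    {K : ℝ} (hK : 0 ≤ K) (hdW : ∀ y₁ y₂, (d y₁ y₂ : ℝ) ≤ K * (W y₁ + W y₂))
    {L M τ : ℝ} {k₀ : ℕ} (hk₀ : 1 ≤ k₀) (hL : 0 ≤ L) (hM : 1 ≤ M) (hτ : τ < 1)
    (hlip : ∀ y₁ y₂, |h y₁ - h y₂| ≤ L * d y₁ y₂)
    (hone : ∀ γ, contractionCoeff d (P.sectR γ) ≤ ENNReal.ofReal M)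
    (hpow : ∀ γ, contractionCoeff d (P.sectR γ ^ k₀) ≤ ENNReal.ofReal τ)
    {π : I → Measure S} (hπprob : ∀ γ, IsProbabilityMeasure (π γ))
    (hπ : ∀ γ, (P.sectR γ).Invariant (π γ)) {c : ℝ} (hc : ∀ γ, ∫ y, h y ∂(π γ) = c) :
    ∃ (g : I × S → ℝ) (C : ℝ), 0 ≤ C ∧ Measurable g ∧ (∀ q, |g q| ≤ C * W q.2) ∧
      ∀ q, ∫ z, g (q.1, z) ∂(P q) = g q - (h q.2 - c) := by
  have hV1 : ∀ y, 1 ≤ V y := fun y => (hW1 y).trans (hWV y)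
  have hhV : ∀ y, |h y| ≤ V y := fun y => (hhW y).trans (hWV y)
  have hdrift' : ∀ q, ∫ z, V z ∂(P q) ≤ V q.2 + b := fun q => by
    have := hdrift q
    have := hV1 q.2
    nlinarith
  -- a rate for single steps: `ρ = τ^{1/k₀}`, with `1/2` in place of `τ` if that is larger
  obtain ⟨ρ, hρ, hρ1, hτρ⟩ : ∃ ρ : ℝ, 0 < ρ ∧ ρ < 1 ∧ τ ≤ ρ ^ k₀ := by
    have h0 : 0 < max τ (1 / 2) := lt_max_of_lt_right (by norm_num)
    refine ⟨max τ (1 / 2) ^ (k₀ : ℝ)⁻¹, by positivity, ?_, ?_⟩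
    · exact Real.rpow_lt_one h0.le (max_lt hτ (by norm_num)) (by positivity)
    · rw [Real.rpow_inv_natCast_pow h0.le (by omega)]
      exact le_max_left _ _
  set B : ℝ := b / (1 - κ)
  have hB : 0 ≤ B := div_nonneg hb (by linarith)
  have hVπ' : ∀ γ, ∫⁻ y, ENNReal.ofReal (V y) ∂(π γ) ≤ ENNReal.ofReal B := fun γ =>
    lintegral_le_of_invariant (hπ γ) hVm (fun y => zero_le_one.trans (hV1 y)) hκ hb
      (fun y => hV (γ, y)) (fun y => hdrift (γ, y))
  have hVπ : ∀ γ, Integrable V (π γ) := fun γ =>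
    (lintegral_ofReal_ne_top_iff_integrable hVm.aestronglyMeasurable
      (Eventually.of_forall fun y => zero_le_one.trans (hV1 y))).1
      (ne_top_of_le_ne_top ENNReal.ofReal_ne_top (hVπ' γ))
  have hWπ : ∀ γ, Integrable W (π γ) := fun γ => (hVπ γ).mono' hWm.aestronglyMeasurable
    (Eventually.of_forall fun y => by
      rw [Real.norm_of_nonneg (zero_le_one.trans (hW1 y))]
      exact hWV y)
  have hWB : ∀ γ, ∫ y, W y ∂(π γ) ≤ B := fun γ => by
    refine (integral_mono (hWπ γ) (hVπ γ) hWV).trans ?_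
    rw [integral_eq_lintegral_of_nonneg_ae (Eventually.of_forall fun y =>
      zero_le_one.trans (hV1 y)) hVm.aestronglyMeasurable]
    exact ENNReal.toReal_le_of_le_ofReal hB (hVπ' γ)
  set A : ℝ := L * M ^ k₀ / ρ ^ k₀
  have hA : 0 ≤ A := by positivity
  set D : ℝ := A * K * (1 + B)
  have hD : 0 ≤ D := by positivity
  have hterm : ∀ k q, |stepMean P h k q - c| ≤ D * W q.2 * ρ ^ k := by
    rintro k ⟨γ, y⟩
    have hu := integrable_stepMean hh hV hV1 hb hdrift' hhV k γ (hVπ γ)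
    have h1 : stepMean P h k (γ, y) - c
        = ∫ z, (stepMean P h k (γ, y) - stepMean P h k (γ, z)) ∂(π γ) := by
      rw [integral_sub (integrable_const _) hu,
        integral_stepMean_of_invariant hh hV hV1 hb hdrift' hhV (hπ γ) (hVπ γ), hc]
      simp
    have h2 : |stepMean P h k (γ, y) - c|
        ≤ ∫ z, A * ρ ^ k * (K * (W y + W z)) ∂(π γ) := by
      rw [h1]
      refine norm_integral_le_of_norm_le
        (f := fun z => stepMean P h k (γ, y) - stepMean P h k (γ, z))
        (g := fun z => A * ρ ^ k * (K * (W y + W z)))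
        ((((integrable_const _).add (hWπ γ)).const_mul _).const_mul _)
        (Eventually.of_forall fun z => ?_)
      refine (abs_stepMean_sub_le hd hh hVm hV hV1 hb hdrift' hhV hk₀ hL hM hρ hρ1.le hlip hone
        (fun γ => (hpow γ).trans (ENNReal.ofReal_le_ofReal hτρ)) k γ y z).trans ?_
      exact mul_le_mul_of_nonneg_left (hdW y z) (by positivity)
    refine h2.trans ?_
    rw [integral_const_mul, integral_const_mul, integral_add (integrable_const _) (hWπ γ)]
    have h3 : W y + ∫ z, W z ∂(π γ) ≤ (1 + B) * W y := by
      have := hWB γ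
      have := hW1 y
      nlinarith
    simp only [integral_const, probReal_univ, one_smul]
    calc A * ρ ^ k * (K * (W y + ∫ z, W z ∂(π γ))) ≤ A * ρ ^ k * (K * ((1 + B) * W y)) := by gcongr
      _ = D * W y * ρ ^ k := by ring
  have hgeom := summable_geometric_of_lt_one hρ.le hρ1
  have hsum : ∀ q, Summable fun k => stepMean P h k q - c := fun q =>
    (hgeom.mul_left (D * W q.2)).of_norm_bounded fun k => hterm k q
  refine ⟨fun q => ∑' k, (stepMean P h k q - c), D / (1 - ρ),
    div_nonneg hD (by linarith), ?_, ?_, ?_⟩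
  · exact measurable_of_tendsto_metrizable
      (fun n => Finset.measurable_sum (Finset.range n) fun k _ =>
        (measurable_stepMean hh k).sub_const c)
      (tendsto_pi_nhds.2 fun q => by simpa using (hsum q).hasSum.tendsto_sum_nat)
  · intro q
    refine (tsum_of_norm_bounded (f := fun k => stepMean P h k q - c)
      (hgeom.hasSum.mul_left (D * W q.2)) fun k => hterm k q).trans
      (le_of_eq ?_)
    rw [tsum_geometric_of_lt_one hρ.le hρ1]
    ring
  · intro q
    have hWq : Integrable W (P q) := (hV q).mono' hWm.aestronglyMeasurable
      (Eventually.of_forall fun y => by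
        rw [Real.norm_of_nonneg (zero_le_one.trans (hW1 y))]
        exact hWV y)
    have hint : ∀ k, Integrable (fun z => stepMean P h k (q.1, z)) (P q) := fun k =>
      integrable_stepMean hh hV hV1 hb hdrift' hhV k q.1 (hV q)
    have hint' : ∀ k, Integrable (fun z => stepMean P h k (q.1, z) - c) (P q) := fun k =>
      (hint k).sub (integrable_const c)
    have hS : Summable fun k => ∫ z, ‖stepMean P h k (q.1, z) - c‖ ∂(P q) := by
      refine (hgeom.mul_left (∫ z, D * W z ∂(P q))).of_nonneg_of_le
        (fun k => integral_nonneg fun z => norm_nonneg _) fun k => ?_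
      rw [← integral_mul_const]
      exact integral_mono (hint' k).norm ((hWq.const_mul D).mul_const _)
        fun z => hterm k (q.1, z)
    have h1 := hasSum_integral_of_summable_integral_norm hint' hS
    have h2 : ∀ k, ∫ z, (stepMean P h k (q.1, z) - c) ∂(P q) = stepMean P h (k + 1) q - c := by
      intro k
      rw [integral_sub (hint k) (integrable_const c)]
      simp [stepMean]
    simp only [h2] at h1
    simp only
    rw [← h1.tsum_eq, (hsum q).tsum_eq_zero_add]
    simp [stepMean]

end Poisson

/-! ### Almost sure growth of martingales and of nonnegative sequences -/

section AlmostSureBounds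

/-- Kronecker's lemma in its boundedness form: increments of a bounded sequence, multiplied by
monotone weights `w`, have partial sums of order `w`. -/
theorem abs_sum_mul_sub_le {w N : ℕ → ℝ} {C : ℝ} (hw0 : w 0 = 0) (hw : Monotone w)
    (hN : ∀ n, |N n| ≤ C) (n : ℕ) :
    |∑ k ∈ Finset.range n, w (k + 1) * (N (k + 1) - N k)| ≤ 2 * C * w n := by
  have hparts : ∑ k ∈ Finset.range n, w (k + 1) * (N (k + 1) - N k)
      = w n * N n - ∑ k ∈ Finset.range n, (w (k + 1) - w k) * N k := by
    induction n with
    | zero => simp [hw0]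
    | succ n ih =>
      rw [Finset.sum_range_succ, Finset.sum_range_succ, ih]
      ring
  have hwn : 0 ≤ w n := hw0 ▸ hw (Nat.zero_le n)
  have h1 : |∑ k ∈ Finset.range n, (w (k + 1) - w k) * N k| ≤ w n * C := by
    calc |∑ k ∈ Finset.range n, (w (k + 1) - w k) * N k|
        ≤ ∑ k ∈ Finset.range n, |(w (k + 1) - w k) * N k| := Finset.abs_sum_le_sum_abs _ _
      _ ≤ ∑ k ∈ Finset.range n, (w (k + 1) - w k) * C := by
        refine Finset.sum_le_sum fun k _ => ?_
        have h0 : 0 ≤ w (k + 1) - w k := sub_nonneg.2 (hw k.le_succ)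
        rw [abs_mul, abs_of_nonneg h0]
        exact mul_le_mul_of_nonneg_left (hN k) h0
      _ = w n * C := by rw [← Finset.sum_mul, Finset.sum_range_sub, hw0, sub_zero]
  have h2 : |w n * N n| ≤ w n * C := by
    rw [abs_mul, abs_of_nonneg hwn]
    exact mul_le_mul_of_nonneg_left (hN n) hwn
  rw [hparts]
  have := abs_sub (w n * N n) (∑ k ∈ Finset.range n, (w (k + 1) - w k) * N k)
  linarith

variable {Ω : Type*} [mΩ : MeasurableSpace Ω] {μ : Measure Ω}

/-- Nonnegative random variables with bounded means are `O(n^r)` almost surely for every `r > 1`,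
because their weighted sum `∑ X n / (n + 1)^r` has finite mean. -/
theorem ae_exists_le_rpow {X : ℕ → Ω → ℝ} (hX : ∀ n, Measurable (X n)) {R : ℝ}
    (hR : ∀ n, ∫⁻ ω, ENNReal.ofReal (X n ω) ∂μ ≤ ENNReal.ofReal R) {r : ℝ} (hr : 1 < r) :
    ∀ᵐ ω ∂μ, ∃ C : ℝ, 0 ≤ C ∧ ∀ n : ℕ, X n ω ≤ C * ((n + 1 : ℕ) : ℝ) ^ r := by
  set w : ℕ → ℝ := fun n => 1 / ((n + 1 : ℕ) : ℝ) ^ r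
  have hw0 : ∀ n, 0 < w n := fun n => by positivity
  have hw : Summable w := (summable_nat_add_iff 1).2 (Real.summable_one_div_nat_rpow.2 hr)
  have hm : ∀ n, Measurable fun ω => ENNReal.ofReal (w n) * ENNReal.ofReal (X n ω) := fun n =>
    ((hX n).ennreal_ofReal).const_mul _
  have hfin : ∫⁻ ω, ∑' n, ENNReal.ofReal (w n) * ENNReal.ofReal (X n ω) ∂μ ≠ ⊤ := by
    rw [lintegral_tsum fun n => (hm n).aemeasurable]
    refine ne_top_of_le_ne_top ?_ (ENNReal.tsum_le_tsum (g := fun n =>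
      ENNReal.ofReal (w n) * ENNReal.ofReal R) fun n => ?_)
    · rw [ENNReal.tsum_mul_right, ← ENNReal.ofReal_tsum_of_nonneg (fun n => (hw0 n).le) hw]
      exact ENNReal.mul_ne_top ENNReal.ofReal_ne_top ENNReal.ofReal_ne_top
    · rw [lintegral_const_mul _ (hX n).ennreal_ofReal]
      exact mul_le_mul_right (hR n) _
  filter_upwards [ae_lt_top (Measurable.tsum hm) hfin] with ω hω
  refine ⟨(∑' n, ENNReal.ofReal (w n) * ENNReal.ofReal (X n ω)).toReal, ENNReal.toReal_nonneg,
    fun n => ?_⟩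
  have h1 := ENNReal.toReal_mono hω.ne
    (ENNReal.le_tsum (f := fun n => ENNReal.ofReal (w n) * ENNReal.ofReal (X n ω)) n)
  rw [ENNReal.toReal_mul, ENNReal.toReal_ofReal (hw0 n).le] at h1
  have h2 : X n ω ≤ (ENNReal.ofReal (X n ω)).toReal := by
    rw [ENNReal.toReal_ofReal']
    exact le_max_left _ _
  have h3 := (mul_le_mul_of_nonneg_left h2 (hw0 n).le).trans h1
  simp only [w] at h3 ⊢
  rwa [one_div_mul_eq_div, div_le_iff₀ (by positivity)] at h3

/-- Partial sums of martingale differences with bounded second moments are `O(n^s)` almost surely,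
for every `s > 1/2`: the martingale with differences `D k / (k + 1)^s` is bounded in `L²`. -/
theorem ae_exists_abs_sum_le_rpow [IsProbabilityMeasure μ] {ℱ : Filtration ℕ mΩ} {D : ℕ → Ω → ℝ}
    (hD : ∀ n, StronglyMeasurable[ℱ (n + 1)] (D n)) (hD2 : ∀ n, MemLp (D n) 2 μ)
    (hD0 : ∀ n, μ[D n | ℱ n] =ᵐ[μ] 0) {R : ℝ} (hR : ∀ n, ∫ ω, D n ω ^ 2 ∂μ ≤ R)
    {s : ℝ} (hs : 1 / 2 < s) :
    ∀ᵐ ω ∂μ, ∃ C : ℝ, ∀ n : ℕ, |∑ k ∈ Finset.range n, D k ω| ≤ C * (n : ℝ) ^ s := by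
  set w : ℕ → ℝ := fun n => (n : ℝ) ^ s
  have hwpos : ∀ n, 0 < w (n + 1) := fun n => by positivity
  set N : ℕ → Ω → ℝ := fun n ω => ∑ k ∈ Finset.range n, (w (k + 1))⁻¹ * D k ω
  have hNsucc : ∀ n, N (n + 1) = fun ω => N n ω + (w (n + 1))⁻¹ * D n ω := fun n => by
    ext ω
    exact Finset.sum_range_succ _ _
  have hNm : StronglyAdapted ℱ N := fun n =>
    Finset.stronglyMeasurable_fun_sum _ fun k hk =>
      ((hD k).mono (ℱ.mono (Finset.mem_range.1 hk))).const_mul _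
  have hN2 : ∀ n, MemLp (N n) 2 μ := fun n =>
    memLp_finsetSum _ fun k _ => (hD2 k).const_mul _
  have hNint : ∀ n, Integrable (N n) μ := fun n => (hN2 n).integrable one_le_two
  have hmart : Martingale N ℱ μ := by
    refine martingale_of_condExp_sub_eq_zero_nat hNm hNint fun n => ?_
    have h1 : N (n + 1) - N n = (w (n + 1))⁻¹ • D n := by
      rw [hNsucc]
      ext ω
      simp
    rw [h1]
    filter_upwards [condExp_smul (w (n + 1))⁻¹ (D n) (ℱ n), hD0 n] with ω h2 h3
    rw [h2, Pi.smul_apply, h3]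
    simp
  have hsum : Summable fun k : ℕ => ((w (k + 1))⁻¹) ^ 2 := by
    have h1 : Summable fun k : ℕ => 1 / ((k : ℝ)) ^ (2 * s) :=
      Real.summable_one_div_nat_rpow.2 (by linarith)
    refine ((summable_nat_add_iff 1).2 h1).congr fun k => ?_
    rw [inv_pow, one_div, ← Real.rpow_mul_natCast (by positivity), mul_comm s]
    norm_num
  have hR0 : 0 ≤ R := (integral_nonneg fun ω => sq_nonneg _).trans (hR 0)
  have horth : ∀ n, ∫ ω, N n ω * D n ω ∂μ = 0 := by
    intro n
    have hint : Integrable (N n * D n) μ := (hN2 n).integrable_mul (hD2 n)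
    have h1 : ∫ ω, (μ[N n * D n | ℱ n]) ω ∂μ = ∫ ω, (N n * D n) ω ∂μ := integral_condExp (ℱ.le n)
    rw [integral_congr_ae (g := fun _ => (0 : ℝ))] at h1
    · simpa using h1.symm
    · filter_upwards [condExp_mul_of_stronglyMeasurable_left (hNm n) hint
        ((hD2 n).integrable one_le_two), hD0 n] with ω h2 h3
      rw [h2, Pi.mul_apply, h3]
      simp
  have hsq : ∀ n, ∫ ω, N n ω ^ 2 ∂μ ≤ R * ∑ k ∈ Finset.range n, ((w (k + 1))⁻¹) ^ 2 := by
    intro n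
    induction n with
    | zero => simp [N]
    | succ n ih =>
      have h1 : ∫ ω, N (n + 1) ω ^ 2 ∂μ = ∫ ω, N n ω ^ 2 ∂μ
          + (w (n + 1))⁻¹ ^ 2 * ∫ ω, D n ω ^ 2 ∂μ := by
        have e : ∀ ω, N (n + 1) ω ^ 2 = N n ω ^ 2 + 2 * (w (n + 1))⁻¹ * (N n ω * D n ω)
            + (w (n + 1))⁻¹ ^ 2 * D n ω ^ 2 := fun ω => by
          rw [hNsucc]
          ring
        have i1 : Integrable (fun ω => N n ω ^ 2) μ := (hN2 n).integrable_sq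
        have i2 : Integrable (fun ω => 2 * (w (n + 1))⁻¹ * (N n ω * D n ω)) μ :=
          ((hN2 n).integrable_mul (hD2 n)).const_mul _
        have i3 : Integrable (fun ω => (w (n + 1))⁻¹ ^ 2 * D n ω ^ 2) μ :=
          (hD2 n).integrable_sq.const_mul _
        have i12 : Integrable (fun ω => N n ω ^ 2 + 2 * (w (n + 1))⁻¹ * (N n ω * D n ω)) μ :=
          i1.add i2
        simp_rw [e]
        rw [integral_add i12 i3, integral_add i1 i2, integral_const_mul, integral_const_mul,
          horth, mul_zero, add_zero]
      rw [h1, Finset.sum_range_succ, mul_add]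
      have h2 := mul_le_mul_of_nonneg_left (hR n) (sq_nonneg (w (n + 1))⁻¹)
      linarith
  set Z : ℝ := 1 + R * ∑' k, ((w (k + 1))⁻¹) ^ 2
  have hL1 : ∀ n, eLpNorm (N n) 1 μ ≤ (Z.toNNReal : ℝ≥0∞) := by
    intro n
    rw [eLpNorm_one_eq_lintegral_enorm, ← ofReal_integral_norm_eq_lintegral_enorm (hNint n)]
    refine ENNReal.ofReal_le_ofReal ?_
    have i1 : Integrable (fun ω => 1 + N n ω ^ 2) μ :=
      (integrable_const _).add (hN2 n).integrable_sq
    calc ∫ ω, ‖N n ω‖ ∂μ ≤ ∫ ω, (1 + N n ω ^ 2) ∂μ := by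
          refine integral_mono (hNint n).norm i1 fun ω => ?_
          simp only [Real.norm_eq_abs]
          rw [← sq_abs]
          nlinarith [sq_nonneg (|N n ω| - 1)]
      _ = 1 + ∫ ω, N n ω ^ 2 ∂μ := by
          rw [integral_add (integrable_const _) (hN2 n).integrable_sq]
          simp
      _ ≤ Z := by
          have := hsum.sum_le_tsum (Finset.range n) fun k _ => sq_nonneg _
          have := mul_le_mul_of_nonneg_left this hR0
          have := hsq n
          simp only [Z]
          linarith
  filter_upwards [hmart.submartingale.exists_ae_tendsto_of_bdd hL1] with ω ⟨l, hl⟩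
  obtain ⟨C, hC⟩ := (Metric.isBounded_range_of_tendsto _ hl).exists_norm_le
  have hN : ∀ n, |N n ω| ≤ C := fun n => hC _ ⟨n, rfl⟩
  refine ⟨2 * C, fun n => ?_⟩
  have hw0 : w 0 = 0 := by
    simp only [w, Nat.cast_zero]
    exact Real.zero_rpow (by linarith)
  have hwmono : Monotone w := fun m n hmn =>
    Real.rpow_le_rpow (Nat.cast_nonneg m) (Nat.cast_le.2 hmn) (by linarith)
  have h1 := abs_sum_mul_sub_le (N := fun n => N n ω) hw0 hwmono hN n
  have h2 : ∀ k, w (k + 1) * (N (k + 1) ω - N k ω) = D k ω := by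
    intro k
    rw [hNsucc]
    field_simp [(hwpos k).ne']
    ring
  simpa only [h2] using h1

end AlmostSureBounds

/-! ### Conditional expectations and moments along the chain -/

section Chain

variable {Ω S I : Type*} [MeasurableSpace S] [MeasurableSpace I] {Y : ℕ → Ω → S} {Γ : ℕ → Ω → I}

theorem measurable_state_history {i n : ℕ} (hi : i ≤ n) : Measurable[history Y Γ n] (Y i) :=
  measurable_iff_comap_le.2 <| le_sup_left.trans <|
    le_iSup₂_of_le (f := fun i (_ : i ∈ Finset.range (n + 1)) =>
      (MeasurableSpace.comap (Y i) inferInstance ⊔ MeasurableSpace.comap (Γ i) inferInstance))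
      i (Finset.mem_range.2 (Nat.lt_succ_of_le hi)) le_rfl

theorem measurable_param_history {i n : ℕ} (hi : i ≤ n) : Measurable[history Y Γ n] (Γ i) :=
  measurable_iff_comap_le.2 <| le_sup_right.trans <|
    le_iSup₂_of_le (f := fun i (_ : i ∈ Finset.range (n + 1)) =>
      (MeasurableSpace.comap (Y i) inferInstance ⊔ MeasurableSpace.comap (Γ i) inferInstance))
      i (Finset.mem_range.2 (Nat.lt_succ_of_le hi)) le_rfl

variable [mΩ : MeasurableSpace Ω] {μ : Measure Ω} [IsProbabilityMeasure μ]
  {P : Kernel (I × S) S} [IsMarkovKernel P] {y₀ : S} {γ₀ : I}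

/-- The filtration of the histories of the chain. -/
def historyFiltration (hY : ∀ n, Measurable (Y n)) (hΓ : ∀ n, Measurable (Γ n)) :
    Filtration ℕ mΩ where
  seq := history Y Γ
  mono' _ _ hmn := biSup_mono fun _ hi =>
    Finset.mem_range.2 ((Finset.mem_range.1 hi).trans_le (Nat.succ_le_succ hmn))
  le' _ := iSup₂_le fun i _ => sup_le (hY i).comap_le (hΓ i).comap_le

/-- On every event of the history, the joint law of `(Γₙ, Yₙ)` and `Yₙ₊₁` is the composition of the
law of `(Γₙ, Yₙ)` with the kernel. -/
theorem IsAdaptiveChain.map_restrict_eq_compProd (hc : IsAdaptiveChain μ P y₀ γ₀ Y Γ) (n : ℕ)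
    {A : Set Ω} (hA : MeasurableSet[history Y Γ n] A) :
    (μ.restrict A).map (fun ω => ((Γ n ω, Y n ω), Y (n + 1) ω))
      = ((μ.restrict A).map fun ω => (Γ n ω, Y n ω)) ⊗ₘ P := by
  have hle : history Y Γ n ≤ mΩ :=
    (historyFiltration hc.measurable_state hc.measurable_param).le n
  have hq : Measurable fun ω => (Γ n ω, Y n ω) :=
    (hc.measurable_param n).prodMk (hc.measurable_state n)
  have hq' : Measurable[history Y Γ n] fun ω => (Γ n ω, Y n ω) :=
    (measurable_param_history le_rfl).prodMk (measurable_state_history le_rfl)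
  have hY := hc.measurable_state (n + 1)
  refine Measure.ext_prod fun {s t} hs ht => ?_
  have hA' : MeasurableSet[history Y Γ n] (A ∩ (fun ω => (Γ n ω, Y n ω)) ⁻¹' s) :=
    hA.inter (hq' hs)
  rw [Measure.compProd_apply_prod hs ht, setLIntegral_map hs (P.measurable_coe ht) hq,
    Measure.restrict_restrict (hq hs), Set.inter_comm _ A,
    Measure.map_apply (hq.prodMk hY) (hs.prod ht),
    Measure.restrict_apply (hq.prodMk hY (hs.prod ht))]
  set A' := A ∩ (fun ω => (Γ n ω, Y n ω)) ⁻¹' s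
  have h1 : ((fun ω => ((Γ n ω, Y n ω), Y (n + 1) ω)) ⁻¹' s ×ˢ t) ∩ A
      = Y (n + 1) ⁻¹' t ∩ A' := by
    ext ω
    simp only [A', Set.mem_inter_iff, Set.mem_preimage, Set.mem_prod]
    tauto
  have h2 := setIntegral_condExp hle (μ := μ) (s := A')
    (f := (Y (n + 1) ⁻¹' t).indicator fun _ => (1 : ℝ))
    ((integrable_const 1).indicator (hY ht)) hA'
  rw [setIntegral_congr_ae (g := fun ω => (P (Γ n ω, Y n ω)).real t) (hle _ hA')
      ((hc.transition n t ht).mono fun ω h _ => h),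
    integral_indicator (hY ht), Measure.restrict_restrict (hY ht)] at h2
  simp only [integral_const, smul_eq_mul, mul_one, measureReal_restrict_apply_univ] at h2
  have h3 : Measurable fun ω => (P (Γ n ω, Y n ω)).real t :=
    ((P.measurable_coe ht).comp hq).ennreal_toReal
  have h4 : Integrable (fun ω => (P (Γ n ω, Y n ω)).real t) (μ.restrict A') :=
    Integrable.of_bound h3.aestronglyMeasurable 1 (Eventually.of_forall fun ω => by
      rw [Real.norm_of_nonneg measureReal_nonneg]
      exact measureReal_le_one)
  rw [h1, ← ofReal_measureReal, ← h2, ofReal_integral_eq_lintegral_ofReal h4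
    (Eventually.of_forall fun ω => measureReal_nonneg)]
  refine lintegral_congr fun ω => ?_
  exact ofReal_measureReal

/-- The transition property for functions that depend also on the current parameter, which is
known at time `n`. -/
theorem IsAdaptiveChain.condExp_eq_integral (hc : IsAdaptiveChain μ P y₀ γ₀ Y Γ) (n : ℕ)
    {g : I × S → ℝ} (hg : Measurable g) (hint : Integrable (fun ω => g (Γ n ω, Y (n + 1) ω)) μ) :
    μ[fun ω => g (Γ n ω, Y (n + 1) ω) | history Y Γ n]
      =ᵐ[μ] fun ω => ∫ z, g (Γ n ω, z) ∂(P (Γ n ω, Y n ω)) := by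
  have hle : history Y Γ n ≤ mΩ :=
    (historyFiltration hc.measurable_state hc.measurable_param).le n
  have hq : Measurable fun ω => (Γ n ω, Y n ω) :=
    (hc.measurable_param n).prodMk (hc.measurable_state n)
  have hq' : Measurable[history Y Γ n] fun ω => (Γ n ω, Y n ω) :=
    (measurable_param_history le_rfl).prodMk (measurable_state_history le_rfl)
  have hG : Measurable fun x : (I × S) × S => g (x.1.1, x.2) :=
    hg.comp (measurable_fst.fst.prodMk measurable_snd)
  have hPg : StronglyMeasurable fun q : I × S => ∫ z, g (q.1, z) ∂(P q) :=
    hG.stronglyMeasurable.integral_kernel_prod_right' (κ := P)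
  have htriple := hq.prodMk (hc.measurable_state (n + 1))
  have hintA : ∀ A, MeasurableSet[history Y Γ n] A → Integrable
      (fun x : (I × S) × S => g (x.1.1, x.2)) (((μ.restrict A).map fun ω => (Γ n ω, Y n ω)) ⊗ₘ P) := by
    intro A hA
    rw [← hc.map_restrict_eq_compProd n hA, integrable_map_measure hG.aestronglyMeasurable
      htriple.aemeasurable]
    exact hint.integrableOn
  have hintP : ∀ A, MeasurableSet[history Y Γ n] A →
      IntegrableOn (fun ω => ∫ z, g (Γ n ω, z) ∂(P (Γ n ω, Y n ω))) A μ := by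
    intro A hA
    have : Integrable (fun q : I × S => ∫ z, g (q.1, z) ∂(P q))
        ((μ.restrict A).map fun ω => (Γ n ω, Y n ω)) := by
      have h1 := (Measure.integrable_compProd_iff (hintA A hA).1).1 (hintA A hA)
      exact h1.2.mono' hPg.aestronglyMeasurable
        (Eventually.of_forall fun q => norm_integral_le_integral_norm _)
    rwa [integrable_map_measure hPg.aestronglyMeasurable hq.aemeasurable] at this
  refine (ae_eq_condExp_of_forall_setIntegral_eq hle hint (fun A hA _ => hintP A hA)
    (fun A hA _ => ?_) ?_).symm
  · have h1 := Measure.integral_compProd (hintA A hA)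
    rw [← hc.map_restrict_eq_compProd n hA, integral_map htriple.aemeasurable
      hG.aestronglyMeasurable, integral_map hq.aemeasurable hPg.aestronglyMeasurable] at h1
    exact h1.symm
  · exact (hPg.comp_measurable hq').aestronglyMeasurable

/-- The drift condition bounds the mean of `V` along the chain, whatever the adaptation does,
because it holds with the same constants for all parameters. -/
theorem IsAdaptiveChain.lintegral_le (hc : IsAdaptiveChain μ P y₀ γ₀ Y Γ) {V : S → ℝ}
    (hV : Measurable V) (hV0 : ∀ y, 0 ≤ V y) {κ b : ℝ} (hκ0 : 0 ≤ κ) (hκ : κ < 1) (hb : 0 ≤ b)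
    (hdrift : ∀ q, ∫⁻ z, ENNReal.ofReal (V z) ∂(P q) ≤ ENNReal.ofReal (κ * V q.2 + b)) (n : ℕ) :
    ∫⁻ ω, ENNReal.ofReal (V (Y n ω)) ∂μ ≤ ENNReal.ofReal (V y₀ + b / (1 - κ)) := by
  have hκ' : 0 < 1 - κ := sub_pos.2 hκ
  have hR : 0 ≤ V y₀ + b / (1 - κ) := add_nonneg (hV0 y₀) (by positivity)
  induction n with
  | zero =>
    simp only [hc.init_state, lintegral_const, measure_univ, mul_one]
    exact ENNReal.ofReal_le_ofReal (le_add_of_nonneg_right (by positivity))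
  | succ n ih =>
    have hq : Measurable fun ω => (Γ n ω, Y n ω) :=
      (hc.measurable_param n).prodMk (hc.measurable_state n)
    have hG : Measurable fun x : (I × S) × S => ENNReal.ofReal (V x.2) :=
      (hV.comp measurable_snd).ennreal_ofReal
    have hlaw := hc.map_restrict_eq_compProd n MeasurableSet.univ
    rw [Measure.restrict_univ] at hlaw
    calc ∫⁻ ω, ENNReal.ofReal (V (Y (n + 1) ω)) ∂μ
        = ∫⁻ x, ENNReal.ofReal (V x.2) ∂((μ.map fun ω => (Γ n ω, Y n ω)) ⊗ₘ P) := by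
          rw [← hlaw, lintegral_map hG (hq.prodMk (hc.measurable_state (n + 1)))]
      _ = ∫⁻ ω, ∫⁻ z, ENNReal.ofReal (V z) ∂(P (Γ n ω, Y n ω)) ∂μ := by
          rw [Measure.lintegral_compProd hG, lintegral_map
            (hV.ennreal_ofReal.lintegral_kernel (κ := P)) hq]
      _ ≤ ∫⁻ ω, (ENNReal.ofReal κ * ENNReal.ofReal (V (Y n ω)) + ENNReal.ofReal b) ∂μ := by
          refine lintegral_mono fun ω => (hdrift _).trans (le_of_eq ?_)
          rw [ENNReal.ofReal_add (mul_nonneg hκ0 (hV0 _)) hb, ENNReal.ofReal_mul hκ0]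
      _ = ENNReal.ofReal κ * ∫⁻ ω, ENNReal.ofReal (V (Y n ω)) ∂μ + ENNReal.ofReal b := by
          have hVY : Measurable fun ω => V (Y n ω) := hV.comp (hc.measurable_state n)
          rw [lintegral_add_right _ measurable_const, lintegral_const_mul _ hVY.ennreal_ofReal]
          simp
      _ ≤ ENNReal.ofReal κ * ENNReal.ofReal (V y₀ + b / (1 - κ)) + ENNReal.ofReal b := by gcongr
      _ ≤ ENNReal.ofReal (V y₀ + b / (1 - κ)) := by
          rw [← ENNReal.ofReal_mul hκ0, ← ENNReal.ofReal_add (mul_nonneg hκ0 hR) hb]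
          refine ENNReal.ofReal_le_ofReal ?_
          have h1 : b / (1 - κ) * (1 - κ) = b := div_mul_cancel₀ b hκ'.ne'
          nlinarith [hV0 y₀]

end Chain

/-! ### The number of parameter changes -/

section AdaptationTimes

theorem adaptationTime_succ (β : ℝ) (m : ℕ) :
    adaptationTime β (m + 1) = adaptationTime β m + ⌈((m + 1 : ℕ) : ℝ) ^ β⌉₊ :=
  Finset.sum_Icc_succ_top (by omega) _

theorem strictMono_adaptationTime (β : ℝ) : StrictMono (adaptationTime β) :=
  strictMono_nat_of_lt_succ fun m => by
    rw [adaptationTime_succ]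
    exact Nat.lt_add_of_pos_right (Nat.ceil_pos.2 (by positivity))

theorem rpow_le_mul_adaptationTime {β : ℝ} (hβ : 0 ≤ β) (m : ℕ) :
    (m : ℝ) ^ (1 + β) ≤ (1 + β) * adaptationTime β m := by
  induction m with
  | zero => simp [adaptationTime, Real.zero_rpow (by linarith : 1 + β ≠ 0)]
  | succ m ih =>
    set x : ℝ := ((m + 1 : ℕ) : ℝ) with hx
    have hx1 : 1 ≤ x := by simp [hx]
    have hx0 : 0 < x := by linarith
    -- Bernoulli's inequality at `m = x (1 - 1/x)` bounds the increment of `m ^ (1 + β)`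
    have h1 := one_add_mul_self_le_rpow_one_add (s := -(1 / x))
      (by rw [neg_le_neg_iff, div_le_one hx0]; exact hx1) (p := 1 + β) (by linarith)
    have h2 : (m : ℝ) = x * (1 + -(1 / x)) := by
      rw [hx]
      field_simp
      push_cast
      ring
    have h3 : 0 ≤ 1 + -(1 / x) := by
      rw [← sub_eq_add_neg, sub_nonneg, div_le_one hx0]
      exact hx1
    have h4 : x ^ (1 + β) - (1 + β) * x ^ β ≤ (m : ℝ) ^ (1 + β) := by
      rw [h2, Real.mul_rpow hx0.le h3]
      refine le_trans (le_of_eq ?_) (mul_le_mul_of_nonneg_left h1 (by positivity))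
      rw [Real.rpow_add hx0, Real.rpow_one]
      field_simp
      ring
    have h5 : x ^ β ≤ (⌈x ^ β⌉₊ : ℝ) := Nat.le_ceil _
    rw [adaptationTime_succ]
    push_cast
    rw [mul_add]
    have h6 := mul_le_mul_of_nonneg_left h5 (by linarith : 0 ≤ 1 + β)
    simp only [hx] at *
    push_cast at *
    linarith

/-- A parameter sequence that is constant between adaptation times changes at most
`((1 + β) n)^{1/(1+β)}` times up to time `n`. -/
theorem card_changes_le {α : Type*} {β : ℝ} (hβ : 0 ≤ β) {γ : ℕ → α}
    (hγ : ∀ j : ℕ, ∀ i₁ ∈ Set.Ico (adaptationTime β j) (adaptationTime β (j + 1)),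
      ∀ i₂ ∈ Set.Ico (adaptationTime β j) (adaptationTime β (j + 1)), γ i₁ = γ i₂)
    (n : ℕ) (J : Finset ℕ) (hJ : ∀ k ∈ J, k < n ∧ γ (k + 1) ≠ γ k) :
    (J.card : ℝ) ≤ ((1 + β) * n) ^ (1 / (1 + β)) := by
  set X : ℝ := ((1 + β) * n) ^ (1 / (1 + β)) with hX
  have hX0 : 0 ≤ X := by positivity
  have hT := strictMono_adaptationTime β
  have hsub : J.image Nat.succ ⊆ (Finset.Icc 1 ⌊X⌋₊).image (adaptationTime β) := by
    intro i hi
    obtain ⟨k, hk, rfl⟩ := Finset.mem_image.1 hi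
    obtain ⟨hkn, hne⟩ := hJ k hk
    obtain ⟨j, hj1, hj2⟩ : ∃ j, adaptationTime β j ≤ k ∧ k < adaptationTime β (j + 1) := by
      have hex : ∃ m, k < adaptationTime β m := ⟨k + 1, hT.le_apply.trans_lt' k.lt_succ_self⟩
      have h0 : Nat.find hex ≠ 0 := fun h => by
        have := Nat.find_spec hex
        rw [h] at this
        simp [adaptationTime] at this
      obtain ⟨j, hj⟩ := Nat.exists_eq_succ_of_ne_zero h0
      refine ⟨j, not_lt.1 (Nat.find_min hex (by omega)), ?_⟩
      have := Nat.find_spec hex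
      rwa [hj] at this
    have hend : adaptationTime β (j + 1) = k + 1 := by
      by_contra h
      exact hne (hγ j (k + 1) ⟨by omega, by omega⟩ k ⟨hj1, hj2⟩)
    refine Finset.mem_image.2 ⟨j + 1, Finset.mem_Icc.2 ⟨by omega, Nat.le_floor ?_⟩, hend⟩
    have h1 := rpow_le_mul_adaptationTime hβ (j + 1)
    rw [hend] at h1
    have h2 : ((j + 1 : ℕ) : ℝ) ^ (1 + β) ≤ (1 + β) * n :=
      h1.trans (mul_le_mul_of_nonneg_left (by exact_mod_cast hkn) (by linarith))
    have h3 := Real.rpow_le_rpow (by positivity) h2 (by positivity : 0 ≤ 1 / (1 + β))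
    rwa [← Real.rpow_mul (by positivity), mul_one_div_cancel (by linarith), Real.rpow_one] at h3
  have h1 : J.card ≤ ⌊X⌋₊ := by
    rw [← Finset.card_image_of_injective J Nat.succ_injective]
    exact (Finset.card_le_card hsub).trans (Finset.card_image_le.trans (by simp))
  exact (Nat.cast_le.2 h1).trans (Nat.floor_le hX0)

end AdaptationTimes

/-! ### Almost sure bounds for the sums along the chain -/

section Assembly

/-- Summation by parts of the differences `G(γₖ, yₖ) - G(γₖ, yₖ₊₁)`: within a block of constant
parameter they telescope, so only the two ends and the changes of parameter contribute. -/
theorem abs_sum_sub_le_of_card_changes_le {S I : Type*} {g : I × S → ℝ} {y : ℕ → S} {γ : ℕ → I}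
    {B X : ℝ} {n : ℕ} (hB : ∀ k ≤ n + 1, ∀ i, |g (i, y k)| ≤ B)
    (hX : ∀ J : Finset ℕ, (∀ k ∈ J, k < n ∧ γ (k + 1) ≠ γ k) → (J.card : ℝ) ≤ X) :
    |∑ k ∈ Finset.range (n + 1), (g (γ k, y k) - g (γ k, y (k + 1)))| ≤ 2 * B * (1 + X) := by
  classical
  have hparts : ∀ m, ∑ k ∈ Finset.range (m + 1), (g (γ k, y k) - g (γ k, y (k + 1)))
      = g (γ 0, y 0) - g (γ m, y (m + 1))
        + ∑ k ∈ Finset.range m, (g (γ (k + 1), y (k + 1)) - g (γ k, y (k + 1))) := by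
    intro m
    induction m with
    | zero => simp
    | succ m ih =>
      rw [Finset.sum_range_succ, ih, Finset.sum_range_succ]
      ring
  have hB0 : 0 ≤ B := (abs_nonneg _).trans (hB 0 (Nat.zero_le _) (γ 0))
  have hsum : |∑ k ∈ Finset.range n, (g (γ (k + 1), y (k + 1)) - g (γ k, y (k + 1)))|
      ≤ X * (2 * B) := by
    set J := (Finset.range n).filter fun k => γ (k + 1) ≠ γ k
    have h1 : ∑ k ∈ Finset.range n, (g (γ (k + 1), y (k + 1)) - g (γ k, y (k + 1)))
        = ∑ k ∈ J, (g (γ (k + 1), y (k + 1)) - g (γ k, y (k + 1))) := by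
      refine (Finset.sum_subset (Finset.filter_subset _ _) fun k hk hkJ => ?_).symm
      have : γ (k + 1) = γ k := by
        by_contra h
        exact hkJ (Finset.mem_filter.2 ⟨hk, h⟩)
      rw [this, sub_self]
    have h2 : ∀ k ∈ J, |g (γ (k + 1), y (k + 1)) - g (γ k, y (k + 1))| ≤ 2 * B := fun k hk => by
      have hkn := Finset.mem_range.1 (Finset.mem_filter.1 hk).1
      have h3 := abs_sub (g (γ (k + 1), y (k + 1))) (g (γ k, y (k + 1)))
      have h4 := hB (k + 1) (by omega) (γ (k + 1))
      have h5 := hB (k + 1) (by omega) (γ k)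
      linarith
    rw [h1]
    refine (Finset.abs_sum_le_sum_abs _ _).trans ((Finset.sum_le_sum h2).trans ?_)
    rw [Finset.sum_const, nsmul_eq_mul]
    refine mul_le_mul_of_nonneg_right (hX J fun k hk => ?_) (by positivity)
    exact ⟨Finset.mem_range.1 (Finset.mem_filter.1 hk).1, (Finset.mem_filter.1 hk).2⟩
  rw [hparts]
  have h1 := hB 0 (Nat.zero_le _) (γ 0)
  have h2 := hB (n + 1) le_rfl (γ n)
  have h3 := abs_add_le (g (γ 0, y 0) - g (γ n, y (n + 1)))
    (∑ k ∈ Finset.range n, (g (γ (k + 1), y (k + 1)) - g (γ k, y (k + 1))))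
  have h4 := abs_sub (g (γ 0, y 0)) (g (γ n, y (n + 1)))
  linarith

/-- An almost sure bound whose random constant depends on `ω` arbitrarily can be attained with a
measurable constant, the supremum of the normalized sequence. -/
theorem exists_measurable_bound {Ω : Type*} [MeasurableSpace Ω] {μ : Measure Ω} {F : ℕ → Ω → ℝ}
    (hF : ∀ n, Measurable (F n)) {w : ℕ → ℝ} (hw : ∀ n, 1 ≤ n → 0 < w n)
    (h : ∀ᵐ ω ∂μ, ∃ C : ℝ, ∀ n, 1 ≤ n → F n ω ≤ w n * C) :
    ∃ C : Ω → ℝ, Measurable C ∧ ∀ᵐ ω ∂μ, ∀ n, 1 ≤ n → F n ω ≤ w n * C ω := by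
  refine ⟨fun ω => ⨆ n : ℕ, F (n + 1) ω / w (n + 1),
    Measurable.iSup fun n => (hF (n + 1)).div_const _, ?_⟩
  filter_upwards [h] with ω ⟨C, hC⟩ n hn
  have hbdd : BddAbove (Set.range fun n : ℕ => F (n + 1) ω / w (n + 1)) := by
    refine ⟨C, ?_⟩
    rintro _ ⟨m, rfl⟩
    rw [div_le_iff₀ (hw _ (by omega)), mul_comm]
    exact hC _ (by omega)
  obtain ⟨m, rfl⟩ : ∃ m, n = m + 1 := ⟨n - 1, by omega⟩
  have h1 := le_ciSup hbdd m
  rwa [div_le_iff₀ (hw _ hn), mul_comm] at h1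

variable {Ω S I : Type*} [mΩ : MeasurableSpace Ω] [MeasurableSpace S] [MeasurableSpace I]
  {μ : Measure Ω} [IsProbabilityMeasure μ] {P : Kernel (I × S) S} [IsMarkovKernel P]
  {y₀ : S} {γ₀ : I} {Y : ℕ → Ω → S} {Γ : ℕ → Ω → I}

/-- The sums of `g(Γₖ, Yₖ₊₁) - P_{Γₖ} g_{Γₖ}(Yₖ)`, which are martingale differences, are `O(n^s)`
almost surely for every `s > 1/2`. -/
theorem IsAdaptiveChain.ae_exists_abs_sum_le (hc : IsAdaptiveChain μ P y₀ γ₀ Y Γ) {g : I × S → ℝ}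
    (hg : Measurable g) {V W : S → ℝ} (hV : Measurable V) {C C' : ℝ}
    (hWV : ∀ y, W y ^ 2 ≤ V y) (hgW : ∀ q, |g q| ≤ C * W q.2)
    (hPgW : ∀ q, |∫ z, g (q.1, z) ∂(P q)| ≤ C' * W q.2) {R : ℝ} (hR0 : 0 ≤ R)
    (hR : ∀ n, ∫⁻ ω, ENNReal.ofReal (V (Y n ω)) ∂μ ≤ ENNReal.ofReal R) {s : ℝ} (hs : 1 / 2 < s) :
    ∀ᵐ ω ∂μ, ∃ A : ℝ, ∀ n : ℕ, |∑ k ∈ Finset.range n,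
      (g (Γ k ω, Y (k + 1) ω) - ∫ z, g (Γ k ω, z) ∂(P (Γ k ω, Y k ω)))| ≤ A * (n : ℝ) ^ s := by
  have hV0 : ∀ y, 0 ≤ V y := fun y => (sq_nonneg _).trans (hWV y)
  have hVY : ∀ n, Measurable fun ω => V (Y n ω) := fun n => hV.comp (hc.measurable_state n)
  have hVint : ∀ n, Integrable (fun ω => V (Y n ω)) μ := fun n =>
    (lintegral_ofReal_ne_top_iff_integrable (hVY n).aestronglyMeasurable
      (Eventually.of_forall fun ω => hV0 _)).1 (ne_top_of_le_ne_top ENNReal.ofReal_ne_top (hR n))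
  have hVR : ∀ n, ∫ ω, V (Y n ω) ∂μ ≤ R := fun n => by
    rw [integral_eq_lintegral_of_nonneg_ae (Eventually.of_forall fun ω => hV0 _)
      (hVY n).aestronglyMeasurable]
    exact ENNReal.toReal_le_of_le_ofReal hR0 (hR n)
  have hPg : Measurable fun q : I × S => ∫ z, g (q.1, z) ∂(P q) := by
    have hG : Measurable fun x : (I × S) × S => g (x.1.1, x.2) :=
      hg.comp (measurable_fst.fst.prodMk measurable_snd)
    exact (hG.stronglyMeasurable.integral_kernel_prod_right' (κ := P)).measurable
  set ℱ := historyFiltration hc.measurable_state hc.measurable_param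
  have hle : ∀ n, history Y Γ n ≤ mΩ := ℱ.le
  have hm1 : ∀ n, Measurable[history Y Γ (n + 1)] fun ω => g (Γ n ω, Y (n + 1) ω) := fun n =>
    hg.comp ((measurable_param_history n.le_succ).prodMk (measurable_state_history le_rfl))
  have hm2 : ∀ n, Measurable[history Y Γ n]
      fun ω => ∫ z, g (Γ n ω, z) ∂(P (Γ n ω, Y n ω)) := fun n =>
    hPg.comp ((measurable_param_history le_rfl).prodMk (measurable_state_history le_rfl))
  -- `|u| ≤ c W` makes `u` square integrable along the chain, because `W² ≤ V`
  have hmem : ∀ (n : ℕ) (u : Ω → ℝ) (c : ℝ), Measurable u →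
      (∀ ω, |u ω| ≤ c * W (Y n ω)) → MemLp u 2 μ ∧ ∫ ω, u ω ^ 2 ∂μ ≤ c ^ 2 * R := by
    intro n u c hu hub
    have hle : ∀ ω, u ω ^ 2 ≤ c ^ 2 * V (Y n ω) := fun ω => by
      rw [← sq_abs]
      calc |u ω| ^ 2 ≤ (c * W (Y n ω)) ^ 2 := by gcongr; exact hub ω
        _ = c ^ 2 * W (Y n ω) ^ 2 := mul_pow _ _ _
        _ ≤ c ^ 2 * V (Y n ω) := mul_le_mul_of_nonneg_left (hWV _) (sq_nonneg c)
    have hi : Integrable (fun ω => u ω ^ 2) μ :=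
      ((hVint n).const_mul (c ^ 2)).mono' (hu.pow_const 2).aestronglyMeasurable
        (Eventually.of_forall fun ω => by
          rw [Real.norm_of_nonneg (sq_nonneg _)]
          exact hle ω)
    refine ⟨(memLp_two_iff_integrable_sq hu.aestronglyMeasurable).2 hi, ?_⟩
    refine (integral_mono hi ((hVint n).const_mul (c ^ 2)) hle).trans ?_
    rw [integral_const_mul]
    exact mul_le_mul_of_nonneg_left (hVR n) (sq_nonneg c)
  have hz := fun n => hmem (n + 1) (fun ω => g (Γ n ω, Y (n + 1) ω)) C
    ((hm1 n).mono (hle _) le_rfl) fun ω => hgW (Γ n ω, Y (n + 1) ω)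
  have hp := fun n => hmem n (fun ω => ∫ z, g (Γ n ω, z) ∂(P (Γ n ω, Y n ω))) C'
    ((hm2 n).mono (hle _) le_rfl) fun ω => hPgW (Γ n ω, Y n ω)
  refine ae_exists_abs_sum_le_rpow (ℱ := ℱ) (D := fun n ω => g (Γ n ω, Y (n + 1) ω)
      - ∫ z, g (Γ n ω, z) ∂(P (Γ n ω, Y n ω)))
    (R := 2 * (C ^ 2 * R) + 2 * (C' ^ 2 * R)) (fun n => ?_) (fun n => (hz n).1.sub (hp n).1)
    (fun n => ?_) (fun n => ?_) hs
  · exact ((hm1 n).sub ((hm2 n).mono (ℱ.mono n.le_succ) le_rfl)).stronglyMeasurable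
  · have i1 := (hz n).1.integrable one_le_two
    have i2 := (hp n).1.integrable one_le_two
    have h1 := condExp_sub i1 i2 (history Y Γ n)
    have h2 := condExp_of_stronglyMeasurable (hle n) (hm2 n).stronglyMeasurable i2
    refine h1.trans ?_
    filter_upwards [hc.condExp_eq_integral n hg i1] with ω h3
    rw [Pi.sub_apply, h3, h2, sub_self]
    rfl
  · have i1 : Integrable (fun ω => 2 * g (Γ n ω, Y (n + 1) ω) ^ 2) μ :=
      (hz n).1.integrable_sq.const_mul 2
    have i2 : Integrable (fun ω => 2 * (∫ z, g (Γ n ω, z) ∂(P (Γ n ω, Y n ω))) ^ 2) μ :=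
      (hp n).1.integrable_sq.const_mul 2
    refine (integral_mono ((hz n).1.sub (hp n).1).integrable_sq (i1.add i2) fun ω => ?_).trans ?_
    · simp only [Pi.add_apply, Pi.sub_apply]
      nlinarith [sq_nonneg (g (Γ n ω, Y (n + 1) ω) + ∫ z, g (Γ n ω, z) ∂(P (Γ n ω, Y n ω)))]
    · rw [integral_add' i1 i2, integral_const_mul, integral_const_mul]
      have h1 := (hz n).2
      have h2 := (hp n).2
      linarith

/-- The sums of `h(Yₖ) - c` along an increasingly rare adaptive chain are `O(n^s)` as soon as the
Poisson equations `g_γ - P_γ g_γ = h - c` have solutions dominated by `V^{1/p}`. The exponent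
`r / p` bounds the growth of `V(Yₙ)^{1/p}` and `1 / (1 + β)` that of the number of adaptations. -/
theorem IsAdaptiveChain.ae_exists_abs_sum_sub_le (hc : IsAdaptiveChain μ P y₀ γ₀ Y Γ) {β : ℝ}
    (hβ : 0 ≤ β) (hair : IsIncreasinglyRare β Γ) {g : I × S → ℝ} (hg : Measurable g)
    {V : S → ℝ} (hV : Measurable V) (hV1 : ∀ y, 1 ≤ V y) {p : ℝ} (hp : 2 ≤ p) {h : S → ℝ} {c : ℝ}
    (hhV : ∀ y, |h y| ≤ V y ^ (1 / p)) {C : ℝ} (hC : 0 ≤ C)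
    (hgV : ∀ q, |g q| ≤ C * V q.2 ^ (1 / p))
    (hpoisson : ∀ q, ∫ z, g (q.1, z) ∂(P q) = g q - (h q.2 - c)) {R : ℝ} (hR0 : 0 ≤ R)
    (hR : ∀ n, ∫⁻ ω, ENNReal.ofReal (V (Y n ω)) ∂μ ≤ ENNReal.ofReal R) {s r : ℝ} (hs : 1 / 2 < s)
    (hr : 1 < r) (hrs : r / p + 1 / (1 + β) ≤ s) :
    ∀ᵐ ω ∂μ, ∃ A : ℝ, ∀ n : ℕ, 1 ≤ n →
      |∑ j ∈ Finset.Icc 1 n, (h (Y j ω) - c)| ≤ A * (n : ℝ) ^ s := by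
  have hp0 : 0 < p := by linarith
  have hV0 : ∀ y, 0 ≤ V y := fun y => zero_le_one.trans (hV1 y)
  have hW1 : ∀ y, 1 ≤ V y ^ (1 / p) := fun y => Real.one_le_rpow (hV1 y) (by positivity)
  have hWV : ∀ y, (V y ^ (1 / p)) ^ 2 ≤ V y := fun y => by
    rw [← Real.rpow_mul_natCast (hV0 y)]
    refine (Real.rpow_le_rpow_of_exponent_le (hV1 y) ?_).trans (Real.rpow_one _).le
    rw [Nat.cast_ofNat, one_div_mul_eq_div, div_le_one hp0]
    exact hp
  have hPgV : ∀ q, |∫ z, g (q.1, z) ∂(P q)| ≤ (C + 1 + |c|) * V q.2 ^ (1 / p) := fun q => by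
    rw [hpoisson]
    have h1 := hgV q
    have h2 := hhV q.2
    have h3 := hW1 q.2
    have h4 : |c| ≤ |c| * V q.2 ^ (1 / p) := le_mul_of_one_le_right (abs_nonneg c) h3
    have h5 := abs_sub (g q) (h q.2 - c)
    have h6 := abs_sub (h q.2) c
    linarith
  filter_upwards [hc.ae_exists_abs_sum_le hg hV hWV hgV hPgV hR0 hR hs,
    ae_exists_le_rpow (fun n => hV.comp (hc.measurable_state n)) hR hr] with ω ⟨A, hA⟩ ⟨G, hG0, hG⟩
  set B : ℝ := C * G ^ (1 / p) * 3 ^ (r / p)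
  have hB0 : 0 ≤ B := by positivity
  set E : ℝ := (1 + β) ^ (1 / (1 + β))
  have hE0 : 0 ≤ E := by positivity
  refine ⟨|A| * 2 ^ s + 2 * B * (1 + E) + |h (Y 0 ω) - c|, fun n hn => ?_⟩
  have hn1 : (1 : ℝ) ≤ n := by exact_mod_cast hn
  have hn0 : (0 : ℝ) < n := by linarith
  have hg' : ∀ k ≤ n + 1, ∀ i, |g (i, Y k ω)| ≤ B * (n : ℝ) ^ (r / p) := by
    intro k hk i
    refine (hgV (i, Y k ω)).trans ?_
    have h1 : V (Y k ω) ^ (1 / p) ≤ G ^ (1 / p) * ((3 : ℝ) * n) ^ (r / p) := by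
      have h2 : ((k + 1 : ℕ) : ℝ) ≤ 3 * n := by
        have : k + 1 ≤ 3 * n := by omega
        exact_mod_cast this
      calc V (Y k ω) ^ (1 / p) ≤ (G * ((k + 1 : ℕ) : ℝ) ^ r) ^ (1 / p) :=
            Real.rpow_le_rpow (hV0 _) (hG k) (by positivity)
        _ = G ^ (1 / p) * ((k + 1 : ℕ) : ℝ) ^ (r / p) := by
            rw [Real.mul_rpow hG0 (by positivity), ← Real.rpow_mul (by positivity), mul_one_div]
        _ ≤ G ^ (1 / p) * (3 * n) ^ (r / p) := by gcongr
    calc C * V (Y k ω) ^ (1 / p) ≤ C * (G ^ (1 / p) * ((3 : ℝ) * n) ^ (r / p)) := by gcongr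
      _ = B * (n : ℝ) ^ (r / p) := by
        rw [Real.mul_rpow (by norm_num) hn0.le]
        ring
  have hJ := abs_sum_sub_le_of_card_changes_le (g := g) (y := fun k => Y k ω)
    (γ := fun k => Γ k ω) hg' fun J hJ => card_changes_le hβ (γ := fun k => Γ k ω)
      (fun j i₁ hi₁ i₂ hi₂ => hair j i₁ hi₁ i₂ hi₂ ω) n J hJ
  have hJ' : 2 * (B * (n : ℝ) ^ (r / p)) * (1 + ((1 + β) * n) ^ (1 / (1 + β)))
      ≤ 2 * B * (1 + E) * (n : ℝ) ^ s := by
    have h1 : 1 + ((1 + β) * n) ^ (1 / (1 + β)) ≤ (1 + E) * (n : ℝ) ^ (1 / (1 + β)) := by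
      rw [Real.mul_rpow (by positivity) hn0.le, add_mul, one_mul]
      gcongr
      exact Real.one_le_rpow hn1 (by positivity)
    calc 2 * (B * (n : ℝ) ^ (r / p)) * (1 + ((1 + β) * n) ^ (1 / (1 + β)))
        ≤ 2 * (B * (n : ℝ) ^ (r / p)) * ((1 + E) * (n : ℝ) ^ (1 / (1 + β))) := by gcongr
      _ = 2 * B * (1 + E) * (n : ℝ) ^ (r / p + 1 / (1 + β)) := by
        rw [Real.rpow_add hn0]
        ring
      _ ≤ 2 * B * (1 + E) * (n : ℝ) ^ s := by
        gcongr
  have hM : |∑ k ∈ Finset.range (n + 1),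
      (g (Γ k ω, Y (k + 1) ω) - ∫ z, g (Γ k ω, z) ∂(P (Γ k ω, Y k ω)))|
      ≤ |A| * 2 ^ s * (n : ℝ) ^ s := by
    refine (hA (n + 1)).trans ?_
    have h1 : ((n + 1 : ℕ) : ℝ) ≤ 2 * n := by
      push_cast
      linarith
    calc A * ((n + 1 : ℕ) : ℝ) ^ s ≤ |A| * (2 * n) ^ s := by
          gcongr
          exact le_abs_self A
      _ = |A| * 2 ^ s * (n : ℝ) ^ s := by
          rw [Real.mul_rpow (by norm_num) hn0.le]
          ring
  have hdecomp : ∑ j ∈ Finset.Icc 1 n, (h (Y j ω) - c)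
      = ∑ k ∈ Finset.range (n + 1),
          (g (Γ k ω, Y (k + 1) ω) - ∫ z, g (Γ k ω, z) ∂(P (Γ k ω, Y k ω)))
        + ∑ k ∈ Finset.range (n + 1), (g (Γ k ω, Y k ω) - g (Γ k ω, Y (k + 1) ω))
        - (h (Y 0 ω) - c) := by
    have h1 : ∑ j ∈ Finset.Icc 1 n, (h (Y j ω) - c)
        = ∑ k ∈ Finset.range (n + 1), (h (Y k ω) - c) - (h (Y 0 ω) - c) := by
      rw [Finset.range_eq_Ico, Finset.sum_eq_sum_Ico_succ_bot (Nat.succ_pos n), add_sub_cancel_left]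
      rfl
    rw [h1, ← Finset.sum_add_distrib]
    congr 1
    refine Finset.sum_congr rfl fun k _ => ?_
    have := hpoisson (Γ k ω, Y k ω)
    simp only at this
    rw [this]
    ring
  have h0 : |h (Y 0 ω) - c| ≤ |h (Y 0 ω) - c| * (n : ℝ) ^ s :=
    le_mul_of_one_le_right (abs_nonneg _) (Real.one_le_rpow hn1 (by linarith))
  rw [hdecomp]
  refine (abs_sub _ _).trans ?_
  refine (add_le_add_left (abs_add_le _ _) _).trans ?_
  have := hJ.trans hJ'
  linarith

end Assembly

end AdaptiveMCMC

theorem mainTheorem8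
    -- the spaces; the state space is `𝓧 × Φ`
    {𝓧 Φ I Ω : Type*}
    [TopologicalSpace 𝓧] [PolishSpace 𝓧] [MeasurableSpace 𝓧] [OpensMeasurableSpace 𝓧]
    [TopologicalSpace Φ] [PolishSpace Φ] [MeasurableSpace Φ] [OpensMeasurableSpace Φ]
    [MeasurableSpace I] [MeasurableSpace Ω]
    (μ : Measure Ω) [IsProbabilityMeasure μ]
    -- the target, the kernels `P_γ = P.sectR γ`, and their invariant laws with marginal `ν`
    (ν : Measure 𝓧) [IsProbabilityMeasure ν]
    (P : Kernel (I × (𝓧 × Φ)) (𝓧 × Φ)) [IsMarkovKernel P]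
    (π : I → Measure (𝓧 × Φ)) (hπ_prob : ∀ γ, IsProbabilityMeasure (π γ))
    (hπ_marginal : ∀ γ, (π γ).map Prod.fst = ν)
    (hπ_inv : ∀ γ, (P.sectR γ).Invariant (π γ))
    -- the increasingly rare adaptive chain
    (β : ℝ) (hβ : 0 < β)
    (y₀ : 𝓧 × Φ) (γ₀ : I) (Y : ℕ → Ω → 𝓧 × Φ) (Γ : ℕ → Ω → I)
    (hchain : AdaptiveMCMC.IsAdaptiveChain μ P y₀ γ₀ Y Γ)
    (hair : AdaptiveMCMC.IsIncreasinglyRare β Γ)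
    -- the uniform contraction assumption
    (d : 𝓧 × Φ → 𝓧 × Φ → ℝ≥0) (hd : AdaptiveMCMC.IsDistanceLike d)
    (M τ : ℝ) (hM : 1 ≤ M) (hτ_nonneg : 0 ≤ τ) (hτ_lt : τ < 1) (k₀ : ℕ) (hk₀ : 1 ≤ k₀)
    (hcontr_one : ∀ γ, AdaptiveMCMC.contractionCoeff d (P.sectR γ) ≤ ENNReal.ofReal M)
    (hcontr : ∀ γ, AdaptiveMCMC.contractionCoeff d ((P.sectR γ) ^ k₀) ≤ ENNReal.ofReal τ)
    -- the Lyapunov function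
    (V : 𝓧 × Φ → ℝ) (hV_meas : Measurable V) (hV_one : ∀ y, 1 ≤ V y)
    (κ b : ℝ) (hκ_pos : 0 < κ) (hκ_lt : κ < 1) (hb : 0 < b)
    (hV_drift : ∀ γ y, ∫⁻ z, ENNReal.ofReal (V z) ∂(P.sectR γ y) ≤ ENNReal.ofReal (κ * V y + b))
    -- the domination of `d` by the Lyapunov function
    (p K : ℝ) (hp : 2 < p) (hK : 0 < K)
    (hdV : ∀ y₁ y₂, (d y₁ y₂ : ℝ) ≤ K * (V y₁ ^ (1 / p) + V y₂ ^ (1 / p)))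
    -- the integrand
    (f : 𝓧 → ℝ) (hf_meas : Measurable f) (hf_int : Integrable f ν)
    (L : ℝ) (hL : 0 < L)
    (hf_lip : ∀ y₁ y₂ : 𝓧 × Φ, |f y₁.1 - f y₂.1| ≤ L * d y₁ y₂)
    (hf_bound : ∀ y : 𝓧 × Φ, |f y.1| ≤ V y ^ (1 / p))
    (ε : ℝ) (hε : max 0 (1 / (1 + β) + 1 / p - 1 / 2) < ε) :
    ∃ C : Ω → ℝ, Measurable C ∧ ∀ᵐ ω ∂μ, ∀ n : ℕ, 1 ≤ n →
      |(1 / (n : ℝ)) * ∑ j ∈ Finset.Icc 1 n, (f (Y j ω).1 - ∫ x, f x ∂ν)|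
        ≤ 1 / (n : ℝ) ^ (1 / 2 - ε) * C ω := by
  have hV0 : ∀ y, 0 ≤ V y := fun y => zero_le_one.trans (hV_one y)
  have hp0 : 0 < p := by linarith
  have hε0 : 0 < ε := (le_max_left _ _).trans_lt hε
  have hε1 : 1 / (1 + β) + 1 / p - 1 / 2 < ε := (le_max_right _ _).trans_lt hε
  have hh : Measurable fun y : 𝓧 × Φ => f y.1 := hf_meas.comp measurable_fst
  have hdrift : ∀ q : I × (𝓧 × Φ),
      ∫⁻ z, ENNReal.ofReal (V z) ∂(P q) ≤ ENNReal.ofReal (κ * V q.2 + b) :=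
    fun q => hV_drift q.1 q.2
  have hVint : ∀ q, Integrable V (P q) := fun q =>
    (lintegral_ofReal_ne_top_iff_integrable hV_meas.aestronglyMeasurable
      (Filter.Eventually.of_forall hV0)).1 (ne_top_of_le_ne_top ENNReal.ofReal_ne_top (hdrift q))
  have hVdrift : ∀ q, ∫ z, V z ∂(P q) ≤ κ * V q.2 + b := fun q => by
    rw [integral_eq_lintegral_of_nonneg_ae (Filter.Eventually.of_forall hV0)
      hV_meas.aestronglyMeasurable]
    exact ENNReal.toReal_le_of_le_ofReal
      (add_nonneg (mul_nonneg hκ_pos.le (hV0 _)) hb.le) (hdrift q)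
  have hmean : ∀ γ, ∫ y, f y.1 ∂(π γ) = ∫ x, f x ∂ν := fun γ => by
    rw [← hπ_marginal γ, integral_map measurable_fst.aemeasurable
      hf_meas.stronglyMeasurable.aestronglyMeasurable]
  obtain ⟨g, C, hC, hg, hgV, hpoisson⟩ := AdaptiveMCMC.exists_poisson_solution
    hd.eq_zero_iff hh hV_meas hVint (hV_meas.pow_const (1 / p))
    (fun y => Real.one_le_rpow (hV_one y) (by positivity))
    (fun y => (Real.rpow_le_rpow_of_exponent_le (hV_one y)
      ((div_le_one hp0).2 (by linarith))).trans (Real.rpow_one _).le)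
    hκ_lt hb.le hVdrift hf_bound hK.le hdV hk₀ hL.le hM hτ_lt hf_lip hcontr_one hcontr hπ_prob
    hπ_inv hmean
  -- the exponent `r` with `r / p + 1 / (1 + β) = 1 / 2 + ε`
  have hr : 1 < p * (1 / 2 + ε - 1 / (1 + β)) := by
    have h1 : p * (1 / p) < p * (1 / 2 + ε - 1 / (1 + β)) :=
      mul_lt_mul_of_pos_left (by linarith) hp0
    rwa [mul_one_div_cancel hp0.ne'] at h1
  have hrs : p * (1 / 2 + ε - 1 / (1 + β)) / p + 1 / (1 + β) ≤ 1 / 2 + ε := by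
    rw [mul_div_cancel_left₀ _ hp0.ne']
    linarith
  have hsum := hchain.ae_exists_abs_sum_sub_le hβ.le hair hg hV_meas hV_one hp.le hf_bound hC hgV
    hpoisson (add_nonneg (hV0 y₀) (div_nonneg hb.le (sub_pos.2 hκ_lt).le))
    (hchain.lintegral_le hV_meas hV0 hκ_pos.le hκ_lt hb.le hdrift)
    (by linarith : 1 / 2 < 1 / 2 + ε) hr hrs
  refine AdaptiveMCMC.exists_measurable_bound (fun n => ?_)
    (fun n hn => by positivity) ?_
  · have hS : Measurable fun ω => ∑ j ∈ Finset.Icc 1 n, (f (Y j ω).1 - ∫ x, f x ∂ν) :=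
      Finset.measurable_sum _ fun j _ => (hh.comp (hchain.measurable_state j)).sub_const _
    exact continuous_abs.measurable.comp (hS.const_mul _)
  · filter_upwards [hsum] with ω ⟨A, hA⟩
    refine ⟨A, fun n hn => ?_⟩
    have hn0 : (0 : ℝ) < n := by exact_mod_cast hn
    rw [abs_mul, abs_of_pos (by positivity)]
    refine (mul_le_mul_of_nonneg_left (hA n hn) (by positivity)).trans (le_of_eq ?_)
    have h1 : (n : ℝ) ^ (1 / 2 + ε) = n * (1 / (n : ℝ) ^ (1 / 2 - ε)) := by
      rw [one_div ((n : ℝ) ^ _), ← Real.rpow_neg hn0.le,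
        ← Real.rpow_one_add' hn0.le (ne_of_gt (by linarith))]
      congr 1
      ring
    rw [h1]
    field_simp
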